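/- Setting. Aggregators form a homogeneous Poisson point process of density $\lambda_a>0$ in the plane, seen from a typical aggregator located at the origin (so the other aggregators form such a process). Each aggregator, the typical one included, has independently a $\mathrm{Poisson}(\bar m)$ number $K$ of devices, $\bar m>0$, placed independently and uniformly in the disk of radius $R_a>0$ around it. There are $N\ge 1$ orthogonal channels, and at most $L\ge 1$ devices of a cluster may share a channel. Random resource scheduling (RRS) works in $L$ rounds in each cluster, independently: in each round, $N$ of the devices not yet served (all of them if fewer than $N$ remain) are chosen uniformly at random and matched one-to-one, uniformly at random, with channels; devices left after $L$ rounds are silent. Let $U$ be the number of devices of a cluster on a given channel and $c_u=\Pr(U=u)$. All channel power coefficients are independent unit-mean exponential variables, the path-loss exponent is $\alpha>2$, and devices invert the path loss to their own aggregator, so that the inter-cluster interference on the channel at the typical aggregator is $$I_r=\sum_{x} g_x\, r_{a,x}^{\alpha}\,\|x\|^{-\alpha},$$ the sum being over the devices of the other clusters that are active on this channel, $r_{a,x}$ being the distance of the device at $x$ to its own aggregator. Let $\theta\ge 0$ and $\mu\in[0,1]$. Let $h$, resp. $h',h''$, be the power coefficients of the device, resp. two devices, of the typical cluster on the channel, and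 put $$\mathrm{SIR}_{1,1}=\frac{h}{I_r},\qquad \mathrm{SIR}_{1,2}=\frac{\max(h',h'')}{I_r+\min(h',h'')},\qquad \mathrm{SIR}_{2,2}=\frac{\min(h',h'')}{I_r+\mu\max(h',h'')},$$ and let $p_{j,u}$ be the conditional probability that $\mathrm{SIR}_{j,u}\ge\theta$, given that $u$ devices of the typical cluster are on the channel. Write $\mathcal L_{I_r}(s)=\mathbb E[e^{-sI_r}]$. Theorem. The interference $I_r$ is almost surely finite, and $$p_{1,1}=\mathcal L_{I_r}(\theta).$$ If $L\ge 2$ (in particular if $L=2$), then $$p_{1,2}=\begin{cases}\frac{2}{1+\theta}\mathcal L_{I_r}(\theta)-\frac{1-\theta}{1+\theta}\mathcal L_{I_r}\!\big(\frac{2\theta}{1-\theta}\big), & 0\le\theta<1,\\[2pt] \frac{2}{1+\theta}\mathcal L_{I_r}(\theta), & \theta\ge 1,\end{cases}\qquad p_{2,2}=\begin{cases}\frac{1-\theta\mu}{1+\theta\mu}\mathcal L_{I_r}\!\big(\frac{2\theta}{1-\theta\mu}\big), & 0\le\theta\mu<1,\\[2pt] 0, & \theta\mu\ge 1.\end{cases}$$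 Moreover, for every $s\ge 0$, $$\mathcal L_{I_r}(s)=\exp\Big(2\pi\lambda_a\int_0^\infty r\Big(\sum_{u=0}^{L}c_u\Upsilon(r,s)^u-1\Big)\,dr\Big),$$ where the integral converges absolutely and $$\Upsilon(r,s)=\frac{1}{\pi R_a^2}\int_0^{R_a}\int_0^{2\pi}\frac{r_a\,d\omega\,dr_a}{1+s\,r_a^{\alpha}\,(r^2+r_a^2+2rr_a\cos\omega)^{-\alpha/2}}.$$ -/

import Mathlib

open MeasureTheory ProbabilityTheory
open scoped ENNReal NNReal

/-! # Uplink of clustered devices under random resource scheduling (RRS) -/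

/-- The Euclidean plane. -/
abbrev Plane : Type := EuclideanSpace ℝ (Fin 2)

/-- The sequence of random points `X ω 0, X ω 1, …` is a homogeneous Poisson point process of
density `lam`: the numbers of points in disjoint bounded Borel sets are independent, and the number
of points in `A` is Poisson with mean `lam * volume A`. -/
def IsHomogeneousPPP {Ω : Type*} [MeasurableSpace Ω] (P : Measure Ω) (lam : ℝ≥0)
    (X : Ω → ℕ → Plane) : Prop :=
  ∀ (n : ℕ) (A : Fin n → Set Plane) (k : Fin n → ℕ),
    (∀ i, MeasurableSet (A i)) → (∀ i, Bornology.IsBounded (A i)) →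
    Pairwise (fun i j => Disjoint (A i) (A j)) →
    P {ω | ∀ i, {l : ℕ | X ω l ∈ A i}.encard = (k i : ℕ∞)} =
      ∏ i, poissonMeasure (lam * (volume (A i)).toNNReal) {k i}

/-! ## The scheduling of one aggregator with `N` channels, at most `L` devices per channel -/

/-- The random choices of RRS in one cluster: the number `k` of devices requiring service, the order
in which they are chosen (device `j` has rank `σ j`), and for each of the `L` rounds a one-to-one
matching of the `N` places of that round with the `N` channels. -/
def Schedule (N L : ℕ) : Type :=
  (k : ℕ) × (Equiv.Perm (Fin k) × (Fin L → Equiv.Perm (Fin N)))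

instance (N L : ℕ) : MeasurableSpace (Schedule N L) := ⊤

/-- The law of the schedule: the number of devices is Poisson with mean `m`; given this number, the
order and the matchings are independent and uniformly distributed. -/
noncomputable def scheduleLaw (m : ℝ≥0) (N L : ℕ) : Measure (Schedule N L) :=
  ((poissonMeasure m).toPMF.bind fun k =>
    (PMF.uniformOfFintype (Equiv.Perm (Fin k) × (Fin L → Equiv.Perm (Fin N)))).map
      (fun x => (⟨k, x⟩ : Schedule N L)) : PMF (Schedule N L)).toMeasure

/-- The devices (numbered from `0`) allocated to channel `n`. Round `l = 0, …, L - 1` serves the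
devices of ranks `l * N, …, l * N + N - 1` (as many of them as there are) and gives the device of
rank `l * N + c` the channel matched with `c` in that round; devices of rank `≥ L * N` are silent. -/
def Schedule.onChannel {N L : ℕ} (a : Schedule N L) (n : Fin N) : Finset ℕ :=
  (Finset.univ.filter fun j : Fin a.1 =>
    ∃ (l : Fin L) (c : Fin N), (a.2.1 j : ℕ) = l * N + c ∧ a.2.2 l c = n).map Fin.valEmbedding

/-- `c_u = Pr(U = u)`, where `U` is the number of devices of a cluster on channel `n`. -/
noncomputable def channelPMF (m : ℝ≥0) (N L : ℕ) (n : Fin N) (u : ℕ) : ℝ :=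
  (scheduleLaw m N L).real {a | (a.onChannel n).card = u}

/-! ## The network -/

/-- All the randomness attached to one cluster: its schedule and, for each device `j`, the
displacement of the device from its aggregator and a channel power coefficient (the coefficient of
the link from the device to the typical aggregator). -/
abbrev ClusterMark (N L : ℕ) : Type := Schedule N L × (ℕ → Plane × ℝ)

/-- The law of a cluster: independent schedule, displacements uniform on the disk of radius `R` and
unit-mean exponential power coefficients. -/
noncomputable def clusterLaw (m : ℝ≥0) (R : ℝ) (N L : ℕ) : Measure (ClusterMark N L) :=
  (scheduleLaw m N L).prod
    (Measure.infinitePi fun _ : ℕ =>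
      (cond (volume : Measure Plane) (Metric.closedBall 0 R)).prod (expMeasure 1))

/-- The network seen from the typical aggregator, which is located at the origin. The other
aggregators form a homogeneous Poisson point process; the clusters (`none`: that of the typical
aggregator, `some i`: that of the `i`-th other aggregator) are i.i.d. and independent of it. -/
structure RRSNetwork {Ω : Type*} [MeasurableSpace Ω] (P : Measure Ω)
    (lam m : ℝ≥0) (R : ℝ) (N L : ℕ) where
  /-- locations of the other aggregators -/
  agg : Ω → ℕ → Plane
  /-- the clusters -/
  mark : Option ℕ → Ω → ClusterMark N L
  measurable_agg : Measurable agg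
  measurable_mark : ∀ i, Measurable (mark i)
  agg_poisson : IsHomogeneousPPP P lam agg
  mark_law : ∀ i, P.map (mark i) = clusterLaw m R N L
  mark_indep : iIndepFun mark P
  agg_indep : IndepFun agg (fun ω i => mark i ω) P

namespace RRSNetwork

variable {Ω : Type*} [MeasurableSpace Ω] {P : Measure Ω} {lam m : ℝ≥0} {R : ℝ} {N L : ℕ}

/-- The devices of cluster `i` that are active on channel `n`. -/
def active (M : RRSNetwork P lam m R N L) (n : Fin N) (i : Option ℕ) (ω : Ω) : Finset ℕ :=
  (M.mark i ω).1.onChannel n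

/-- The displacement of device `j` of cluster `i` from its aggregator. -/
def offset (M : RRSNetwork P lam m R N L) (i : Option ℕ) (j : ℕ) (ω : Ω) : Plane :=
  ((M.mark i ω).2 j).1

/-- The power coefficient of the channel between device `j` of cluster `i` and the typical
aggregator. -/
def fading (M : RRSNetwork P lam m R N L) (i : Option ℕ) (j : ℕ) (ω : Ω) : ℝ :=
  ((M.mark i ω).2 j).2

/-- The inter-cluster interference `I_r` on channel `n` at the typical aggregator, with path-loss
exponent `α`: the sum of `g * r_a ^ α * ‖x‖ ^ (-α)` over the active devices of the other clusters,
where `x` is the location of the device, `r_a` its distance to its own aggregator (full path-loss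
inversion) and `g` the power coefficient. -/
noncomputable def interference (M : RRSNetwork P lam m R N L) (α : ℝ) (n : Fin N) (ω : Ω) : ℝ≥0∞ :=
  ∑' i : ℕ, ∑ j ∈ M.active n (some i) ω,
    ENNReal.ofReal (M.fading (some i) j ω * ‖M.offset (some i) j ω‖ ^ α *
      ‖M.agg ω i + M.offset (some i) j ω‖ ^ (-α))

/-- The Laplace transform `s ↦ E[exp (-s I_r)]` of the interference. -/
noncomputable def laplace (M : RRSNetwork P lam m R N L) (α : ℝ) (n : Fin N) (s : ℝ) : ℝ :=
  ∫ ω, Real.exp (-(s * (M.interference α n ω).toReal)) ∂P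

/-- `u` devices of the typical cluster share channel `n`. -/
def sharing (M : RRSNetwork P lam m R N L) (n : Fin N) (u : ℕ) : Set Ω :=
  {ω | (M.active n none ω).card = u}

end RRSNetwork

/-! ## Signal-to-interference ratios at the typical aggregator -/

/-- SIR of a device alone on its channel. -/
noncomputable def sir₁₁ (h : ℝ) (I : ℝ≥0∞) : ℝ≥0∞ := ENNReal.ofReal h / I

/-- SIR of the first decoded of two devices sharing a channel. -/
noncomputable def sir₁₂ (h h' : ℝ) (I : ℝ≥0∞) : ℝ≥0∞ :=
  ENNReal.ofReal (max h h') / (I + ENNReal.ofReal (min h h'))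

/-- SIR of the second decoded of two devices sharing a channel, where successive interference
cancellation leaves a fraction `μ` of the first signal. -/
noncomputable def sir₂₂ (μ h h' : ℝ) (I : ℝ≥0∞) : ℝ≥0∞ :=
  ENNReal.ofReal (min h h') / (I + ENNReal.ofReal (μ * max h h'))

namespace RRSNetwork

variable {Ω : Type*} [MeasurableSpace Ω] {P : Measure Ω} {lam m : ℝ≥0} {R : ℝ} {N L : ℕ}

/-- `p_{1,1}`: conditional probability that the SIR is at least `θ`, given that exactly one device
of the typical cluster is on channel `n`. -/
noncomputable def p₁₁ (M : RRSNetwork P lam m R N L) (α : ℝ) (n : Fin N) (θ : ℝ) : ℝ :=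
  (cond P (M.sharing n 1)).real
    {ω | ∃ j, M.active n none ω = {j} ∧
      ENNReal.ofReal θ ≤ sir₁₁ (M.fading none j ω) (M.interference α n ω)}

/-- `p_{1,2}`: conditional probability that the SIR of the first decoded device is at least `θ`,
given that two devices of the typical cluster share channel `n`. -/
noncomputable def p₁₂ (M : RRSNetwork P lam m R N L) (α : ℝ) (n : Fin N) (θ : ℝ) : ℝ :=
  (cond P (M.sharing n 2)).real
    {ω | ∃ j j', j ≠ j' ∧ M.active n none ω = {j, j'} ∧
      ENNReal.ofReal θ ≤
        sir₁₂ (M.fading none j ω) (M.fading none j' ω) (M.interference α n ω)}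

/-- `p_{2,2}`: conditional probability that the SIR of the second decoded device is at least `θ`,
given that two devices of the typical cluster share channel `n`. -/
noncomputable def p₂₂ (M : RRSNetwork P lam m R N L) (α μ : ℝ) (n : Fin N) (θ : ℝ) : ℝ :=
  (cond P (M.sharing n 2)).real
    {ω | ∃ j j', j ≠ j' ∧ M.active n none ω = {j, j'} ∧
      ENNReal.ofReal θ ≤
        sir₂₂ μ (M.fading none j ω) (M.fading none j' ω) (M.interference α n ω)}

end RRSNetwork

/-! ## The closed form -/

/-- The disk average `Υ(r_w, s)`. -/
noncomputable def diskAverage (R α rw s : ℝ) : ℝ :=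
  1 / (Real.pi * R ^ 2) * ∫ ra in (0 : ℝ)..R, ∫ ω in (0 : ℝ)..(2 * Real.pi),
    ra / (1 + s * ra ^ α * (rw ^ 2 + ra ^ 2 + 2 * rw * ra * Real.cos ω) ^ (-α / 2))

/-- The integrand `r_w (∑_{u=0}^L c_u Υ(r_w, s)^u - 1)`. -/
noncomputable def laplaceIntegrand (m : ℝ≥0) (R α : ℝ) (N L : ℕ) (n : Fin N) (s rw : ℝ) : ℝ :=
  rw * ((∑ u ∈ Finset.range (L + 1), channelPMF m N L n u * diskAverage R α rw s ^ u) - 1)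

/-!
# Success probabilities and interference of clustered devices

The interference is a sum of independent contributions of the clusters, attached to the points of a
Poisson process, so its Laplace transform is a Laplace functional. Laplace transforms are taken
with `negExp t = exp (-t)` on `[0, ∞]`, where `exp (-∞) = 0`; this needs no finiteness assumption.

* `IsHomogeneousPPP.lintegral_negExp_tsum`: `E[exp (-∑ g (X_l))] = exp (-lam ∫ (1 - exp (-g)))`.
  For step functions this is the joint Poisson law of the counts, and monotone approximation gives
  the general case.
* Given the locations of the aggregators, the clusters contribute independent factors, and a
  cluster at `x` contributes `clusterLaplace x`. As the devices of a cluster are i.i.d. with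
  exponential coefficients, this is `∑ c_u Υ ^ u` (`clusterLaplace_eq_sum`), where `Υ` is an average
  over the disk; polar coordinates turn it into `diskAverage` at `‖x‖`
  (`deviceLaplace_eq_diskAverage`). The Poisson exponent is then a radial integral over the plane,
  which converges because `1 - clusterLaplace x = O(‖x‖ ^ (-α))` with `α > 2` (`one_sub_sum_le`).
* `P (I < ∞)` is the limit at `0` of `E[exp (-s I)]`, hence equal to `1` by dominated convergence in
  the exponent (`RRSNetwork.ae_interference_ne_top`).
* The cluster of the typical aggregator is independent of the interference. Each conditional
  probability is therefore `E[f I]` (`RRSNetwork.cond_sharing_real_eq`), where `f t` is the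
  probability of the event for one or two independent exponential coefficients and interference
  `t`. For two coefficients, symmetry reduces both events to the probability that the smaller one
  exceeds an affine function of the larger one (`expPair_real_affine_le_lt`). The values `f t` are
  combinations of exponentials in `t`, so `E[f I]` is a combination of Laplace transforms.
-/

/-! ### The exponential `t ↦ exp (-t)` on the extended half-line -/

/-- The map `t ↦ exp (-t)` on `[0, ∞]`, with `exp (-∞) = 0`. -/
noncomputable def negExp (t : ℝ≥0∞) : ℝ≥0∞ := EReal.exp (-(t : EReal))

lemma negExp_eq_inv (t : ℝ≥0∞) : negExp t = (EReal.exp (t : EReal))⁻¹ := by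
  rw [negExp, EReal.exp_neg]

@[simp] lemma negExp_zero : negExp 0 = 1 := by simp [negExp]

@[simp] lemma negExp_top : negExp ∞ = 0 := by simp [negExp]

lemma continuous_negExp : Continuous negExp :=
  ENNReal.continuous_exp.comp (continuous_neg.comp continuous_coe_ennreal_ereal)

@[fun_prop]
lemma measurable_negExp : Measurable fun t => negExp t := continuous_negExp.measurable

lemma antitone_negExp : Antitone negExp := fun a b h => by
  unfold negExp
  exact EReal.exp_monotone (EReal.neg_le_neg_iff.2 (by exact_mod_cast h))

lemma negExp_le_one (t : ℝ≥0∞) : negExp t ≤ 1 := by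
  simpa using antitone_negExp (zero_le (a := t))

lemma negExp_ne_top (t : ℝ≥0∞) : negExp t ≠ ∞ := ne_top_of_le_ne_top (by simp) (negExp_le_one t)

lemma negExp_ofReal {x : ℝ} (hx : 0 ≤ x) :
    negExp (ENNReal.ofReal x) = ENNReal.ofReal (Real.exp (-x)) := by
  rw [negExp, EReal.coe_ennreal_ofReal, max_eq_left hx, ← EReal.coe_neg, EReal.exp_coe]

lemma negExp_of_ne_top {t : ℝ≥0∞} (ht : t ≠ ∞) :
    negExp t = ENNReal.ofReal (Real.exp (-t.toReal)) := by
  rw [← negExp_ofReal ENNReal.toReal_nonneg, ENNReal.ofReal_toReal ht]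

lemma negExp_add (a b : ℝ≥0∞) : negExp (a + b) = negExp a * negExp b := by
  simp only [negExp_eq_inv, EReal.coe_ennreal_add, EReal.exp_add]
  have h (t : ℝ≥0∞) : EReal.exp (t : EReal) ≠ 0 := by
    simp
  rw [ENNReal.mul_inv (Or.inl (h a)) (Or.inr (h b))]

lemma negExp_sum {ι : Type*} (s : Finset ι) (f : ι → ℝ≥0∞) :
    negExp (∑ i ∈ s, f i) = ∏ i ∈ s, negExp (f i) := by
  classical
  induction s using Finset.induction_on with
  | empty => simp
  | insert a s ha ih => rw [Finset.sum_insert ha, Finset.prod_insert ha, negExp_add, ih]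

lemma negExp_mul_natCast (a : ℝ≥0∞) (k : ℕ) : negExp (a * k) = negExp a ^ k := by
  have := negExp_sum (Finset.range k) (fun _ => a)
  simpa [mul_comm] using this

/-- Every function with values in `[0, 1]` is of the form `exp (-g)`. -/
lemma exists_measurable_negExp_eq {β : Type*} [MeasurableSpace β] {φ : β → ℝ≥0∞}
    (hφ : Measurable φ) (h1 : ∀ x, φ x ≤ 1) :
    ∃ g : β → ℝ≥0∞, Measurable g ∧ ∀ x, negExp (g x) = φ x := by
  refine ⟨fun x => (-ENNReal.log (φ x)).toENNReal, ?_, fun x => ?_⟩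
  · exact (hφ.ennreal_log.neg).ereal_toENNReal
  · have : ENNReal.log (φ x) ≤ 0 := by
      simpa using ENNReal.log_monotone (h1 x)
    rw [negExp, EReal.coe_toENNReal (by simpa using EReal.neg_le_neg_iff.2 this), neg_neg,
      ENNReal.exp_log]

lemma tendsto_negExp_sum_range (f : ℕ → ℝ≥0∞) :
    Filter.Tendsto (fun n => ∏ i ∈ Finset.range n, negExp (f i)) Filter.atTop
      (nhds (negExp (∑' i, f i))) := by
  simp_rw [← negExp_sum]
  exact (continuous_negExp.tendsto _).comp (ENNReal.tendsto_nat_tsum f)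

/-! ### The Laplace functional of a Poisson point process -/

lemma lintegral_negExp_poissonMeasure (r : ℝ≥0) (a : ℝ≥0∞) :
    ∫⁻ k : ℕ, negExp (a * k) ∂(poissonMeasure r) = negExp (r * (1 - negExp a)) := by
  obtain ⟨q, hq⟩ : ∃ q : ℝ≥0, negExp a = q := ⟨_, (ENNReal.coe_toNNReal (negExp_ne_top a)).symm⟩
  have hq1 : (q : ℝ) ≤ 1 := by
    have := negExp_le_one a
    rw [hq] at this
    exact_mod_cast this
  have hk : ∀ k : ℕ, negExp (a * k) * poissonMeasure r {k} =
      ENNReal.ofReal (Real.exp (-r) * ((r * q) ^ k / k.factorial)) := fun k => by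
    rw [negExp_mul_natCast, hq, poissonMeasure_singleton, ← ENNReal.ofReal_coe_nnreal (p := q),
      ← ENNReal.ofReal_pow (by positivity), ← ENNReal.ofReal_mul (by positivity)]
    congr 1
    rw [mul_pow]; ring
  have hs : HasSum (fun k : ℕ => Real.exp (-r) * ((r * q : ℝ) ^ k / k.factorial))
      (Real.exp (-r) * Real.exp (r * q)) := by
    apply HasSum.mul_left
    rw [Real.exp_eq_exp_ℝ]
    exact NormedSpace.expSeries_div_hasSum_exp (r * q : ℝ)
  rw [lintegral_countable']
  simp_rw [hk]
  rw [← ENNReal.ofReal_tsum_of_nonneg (fun k => by positivity) hs.summable, hs.tsum_eq, hq,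
    ← ENNReal.coe_one, ← ENNReal.coe_sub, ← ENNReal.coe_mul, negExp_of_ne_top ENNReal.coe_ne_top,
    ← Real.exp_add]
  congr 2
  rw [ENNReal.coe_toReal, NNReal.coe_mul, NNReal.coe_sub (by exact_mod_cast hq1)]
  push_cast; ring

lemma encard_eq_tsum_indicator {β : Type*} (x : ℕ → β) (A : Set β) :
    (({l : ℕ | x l ∈ A}.encard : ℕ∞) : ℝ≥0∞) = ∑' l, A.indicator 1 (x l) := by
  rw [← ENNReal.tsum_set_one, tsum_subtype {l : ℕ | x l ∈ A} (fun _ => (1 : ℝ≥0∞))]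
  rfl

namespace IsHomogeneousPPP

variable {Ω : Type*} [MeasurableSpace Ω] {P : Measure Ω} {lam : ℝ≥0} {X : Ω → ℕ → Plane}

/-- The counts of a Poisson process in disjoint bounded sets are almost surely equal to natural
numbers whose joint law is a product of Poisson laws. -/
lemma exists_counts [IsProbabilityMeasure P] (h : IsHomogeneousPPP P lam X) (hX : Measurable X)
    {n : ℕ} {A : Fin n → Set Plane} (hA : ∀ i, MeasurableSet (A i))
    (hb : ∀ i, Bornology.IsBounded (A i)) (hd : Pairwise fun i j => Disjoint (A i) (A j)) :
    ∃ Z : Ω → Fin n → ℕ, Measurable Z ∧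
      (∀ᵐ ω ∂P, ∀ i, ∑' l, (A i).indicator (1 : Plane → ℝ≥0∞) (X ω l) = Z ω i) ∧
      P.map Z = Measure.pi fun i => poissonMeasure (lam * (volume (A i)).toNNReal) := by
  have hmeas : ∀ i, Measurable fun ω => ∑' l, (A i).indicator (1 : Plane → ℝ≥0∞) (X ω l) :=
    fun i => Measurable.tsum fun l =>
      (measurable_one.indicator (hA i)).comp ((measurable_pi_apply l).comp hX)
  have hfin : ∀ i, ∀ᵐ ω ∂P, {l : ℕ | X ω l ∈ A i}.encard ≠ ⊤ := fun i => by
    have h1 : ∀ k : ℕ, P {ω | {l : ℕ | X ω l ∈ A i}.encard = k} =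
        poissonMeasure (lam * (volume (A i)).toNNReal) {k} := fun k => by
      simpa using h 1 (fun _ => A i) (fun _ => k) (fun _ => hA i) (fun _ => hb i)
        (fun a b hab => absurd (Subsingleton.elim a b) hab)
    have hset : ∀ k : ℕ, MeasurableSet {ω | {l : ℕ | X ω l ∈ A i}.encard = k} := fun k => by
      have : {ω | {l : ℕ | X ω l ∈ A i}.encard = k} =
          (fun ω => ∑' l, (A i).indicator (1 : Plane → ℝ≥0∞) (X ω l)) ⁻¹' {(k : ℝ≥0∞)} := by
        ext ω
        simp only [Set.mem_ofPred_eq, Set.mem_preimage, Set.mem_singleton_iff,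
          ← encard_eq_tsum_indicator]
        exact_mod_cast Iff.rfl
      rw [this]
      exact hmeas i (measurableSet_singleton _)
    have h2 : P (⋃ k : ℕ, {ω | {l : ℕ | X ω l ∈ A i}.encard = k}) = 1 := by
      rw [measure_iUnion _ hset]
      · simp_rw [h1]
        have := lintegral_countable' (μ := poissonMeasure (lam * (volume (A i)).toNNReal))
          (fun _ => (1 : ℝ≥0∞))
        simpa using this.symm
      · intro a b hab
        refine Set.disjoint_left.2 fun ω ha hb => hab ?_
        have : (a : ℕ∞) = b := ha.symm.trans hb
        exact_mod_cast this
    have h3 : ∀ᵐ ω ∂P, ω ∈ ⋃ k : ℕ, {ω | {l : ℕ | X ω l ∈ A i}.encard = k} := by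
      rw [← prob_compl_eq_zero_iff (MeasurableSet.iUnion hset)] at h2
      exact h2
    filter_upwards [h3] with ω hω
    obtain ⟨k, hk⟩ := Set.mem_iUnion.1 hω
    rw [hk]
    exact ENat.natCast_ne_top k
  have hZ : Measurable fun ω (i : Fin n) =>
      ⌊(∑' l, (A i).indicator (1 : Plane → ℝ≥0∞) (X ω l)).toReal⌋₊ :=
    measurable_pi_lambda _ fun i => Nat.measurable_floor.comp (hmeas i).ennreal_toReal
  have hae : ∀ᵐ ω ∂P, ∀ i, ({l : ℕ | X ω l ∈ A i}.encard : ℕ∞) =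
      (⌊(∑' l, (A i).indicator (1 : Plane → ℝ≥0∞) (X ω l)).toReal⌋₊ : ℕ) := by
    filter_upwards [ae_all_iff.2 hfin] with ω hω i
    obtain ⟨k, hk⟩ := ENat.ne_top_iff_exists.1 (hω i)
    rw [← encard_eq_tsum_indicator, ← hk]
    simp
  refine ⟨_, hZ, ?_, ?_⟩
  · filter_upwards [hae] with ω hω i
    rw [← encard_eq_tsum_indicator, hω i]
    simp
  · refine Measure.ext_of_singleton fun k => ?_
    rw [Measure.map_apply hZ (measurableSet_singleton _), Measure.pi_singleton,
      ← h n A k hA hb hd]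
    refine measure_congr ?_
    filter_upwards [hae] with ω hω
    refine propext ⟨fun hk i => ?_, fun hk => ?_⟩
    · have := hω i
      rw [this]
      exact congrArg _ (congrFun (show _ = k from hk) i)
    · refine funext fun i => ?_
      have h1 := hω i
      rw [show {l : ℕ | X ω l ∈ A i}.encard = k i from hk i] at h1
      exact_mod_cast h1.symm

lemma lintegral_negExp_sum_indicator_fin [IsProbabilityMeasure P] (h : IsHomogeneousPPP P lam X)
    (hX : Measurable X) {n : ℕ} {A : Fin n → Set Plane} (a : Fin n → ℝ≥0∞)
    (hA : ∀ i, MeasurableSet (A i)) (hb : ∀ i, Bornology.IsBounded (A i))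
    (hd : Pairwise fun i j => Disjoint (A i) (A j)) :
    ∫⁻ ω, negExp (∑' l, ∑ i, (A i).indicator (fun _ => a i) (X ω l)) ∂P =
      negExp (lam * ∑ i, (1 - negExp (a i)) * volume (A i)) := by
  obtain ⟨Z, hZ, hae, hlaw⟩ := h.exists_counts hX hA hb hd
  have h1 : ∫⁻ ω, negExp (∑' l, ∑ i, (A i).indicator (fun _ => a i) (X ω l)) ∂P =
      ∫⁻ ω, ∏ i, negExp (a i * Z ω i) ∂P := by
    refine lintegral_congr_ae ?_
    filter_upwards [hae] with ω hω
    rw [← negExp_sum, Summable.tsum_finsetSum (fun _ _ => ENNReal.summable)]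
    congr 1
    refine Finset.sum_congr rfl fun i _ => ?_
    rw [← hω i, ← ENNReal.tsum_mul_left]
    refine tsum_congr fun l => ?_
    by_cases hl : X ω l ∈ A i <;> simp [hl]
  have hZi : ∀ i, Measurable fun k : Fin n → ℕ => negExp (a i * k i) := fun i =>
    measurable_from_nat (f := fun k : ℕ => negExp (a i * k)) |>.comp (measurable_pi_apply i)
  have hind := iIndepFun_pi (μ := fun i => poissonMeasure (lam * (volume (A i)).toNNReal))
    (X := fun i (k : ℕ) => negExp (a i * k)) (fun i => measurable_from_nat.aemeasurable)
  have h2 : ∫⁻ ω, ∏ i, negExp (a i * Z ω i) ∂P =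
      ∫⁻ k, ∏ i, negExp (a i * (k i : ℕ)) ∂(P.map Z) := by
    rw [lintegral_map (Finset.measurable_prod _ fun i _ => hZi i) hZ]
  rw [h1, h2, hlaw, lintegral_prod_eq_prod_lintegral_of_indepFun _ _ hind hZi, Finset.mul_sum,
    negExp_sum]
  refine Finset.prod_congr rfl fun i _ => ?_
  have := (measurePreserving_eval (fun i => poissonMeasure (lam * (volume (A i)).toNNReal)) i)
  rw [this.lintegral_comp (f := fun k : ℕ => negExp (a i * k)) measurable_from_nat,
    lintegral_negExp_poissonMeasure, ENNReal.coe_mul,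
    ENNReal.coe_toNNReal (hb i).measure_lt_top.ne, mul_comm (1 - negExp (a i)), mul_assoc]

/-- Laplace functional of a Poisson process at a step function with bounded disjoint steps. -/
lemma lintegral_negExp_sum_indicator [IsProbabilityMeasure P] (h : IsHomogeneousPPP P lam X)
    (hX : Measurable X) {ι : Type*} [Fintype ι] {A : ι → Set Plane} (a : ι → ℝ≥0∞)
    (hA : ∀ i, MeasurableSet (A i)) (hb : ∀ i, Bornology.IsBounded (A i))
    (hd : Pairwise fun i j => Disjoint (A i) (A j)) :
    ∫⁻ ω, negExp (∑' l, ∑ i, (A i).indicator (fun _ => a i) (X ω l)) ∂P =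
      negExp (lam * ∑ i, (1 - negExp (a i)) * volume (A i)) := by
  let e := Fintype.equivFin ι
  have := h.lintegral_negExp_sum_indicator_fin hX (A := A ∘ e.symm) (a ∘ e.symm) (fun i => hA _)
    (fun i => hb _) (fun i j hij => hd (e.symm.injective.ne hij))
  simp only [Function.comp_apply] at this
  rw [← e.symm.sum_comp fun i => (1 - negExp (a i)) * volume (A i), ← this]
  refine lintegral_congr fun ω => congrArg _ (tsum_congr fun l => ?_)
  exact (e.symm.sum_comp fun i => (A i).indicator (fun _ => a i) (X ω l)).symm

/-- The Laplace functional of a homogeneous Poisson process, obtained from step functions by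
monotone approximation. -/
theorem lintegral_negExp_tsum [IsProbabilityMeasure P] (h : IsHomogeneousPPP P lam X)
    (hX : Measurable X) {g : Plane → ℝ≥0∞} (hg : Measurable g) :
    ∫⁻ ω, negExp (∑' l, g (X ω l)) ∂P = negExp (lam * ∫⁻ x, (1 - negExp (g x))) := by
  -- `f k` increases to `g`; its steps are bounded because it vanishes outside a ball.
  let f : ℕ → SimpleFunc Plane ℝ≥0∞ := fun k =>
    (SimpleFunc.eapprox g k).restrict (Metric.ball 0 k)
  have hball : ∀ k : ℕ, MeasurableSet (Metric.ball (0 : Plane) k) := fun k => measurableSet_ball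
  have hfx : ∀ k x, f k x = (Metric.ball (0 : Plane) k).indicator (SimpleFunc.eapprox g k) x :=
    fun k x => SimpleFunc.restrict_apply _ (hball k) x
  have hmono : Monotone fun k => (f k : Plane → ℝ≥0∞) := fun k l hkl x => by
    simp only [hfx]
    have hkl' : (k : ℝ) ≤ l := by exact_mod_cast hkl
    refine (Set.indicator_le_indicator_of_subset (Metric.ball_subset_ball hkl')
      (fun _ => zero_le) x).trans ?_
    exact Set.indicator_le_indicator (SimpleFunc.monotone_eapprox g hkl x)
  have hsup : ∀ x, ⨆ k, f k x = g x := fun x => by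
    refine le_antisymm (iSup_le fun k => ?_) ?_
    · rw [hfx]
      refine (Set.indicator_le_self _ _ x).trans ?_
      rw [← SimpleFunc.iSup_eapprox_apply hg x]
      exact le_iSup (fun k => SimpleFunc.eapprox g k x) k
    · rw [← SimpleFunc.iSup_eapprox_apply hg x]
      refine iSup_le fun k => ?_
      obtain ⟨l, hl⟩ := exists_nat_gt ‖x‖
      refine le_iSup_of_le (max k l) ?_
      have hx : x ∈ Metric.ball (0 : Plane) (max k l : ℕ) := by
        simp only [mem_ball_zero_iff]
        exact hl.trans_le (by exact_mod_cast le_max_right k l)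
      rw [hfx, Set.indicator_of_mem hx]
      exact SimpleFunc.monotone_eapprox g (le_max_left k l) x
  have htend : ∀ x, Filter.Tendsto (fun k => f k x) Filter.atTop (nhds (g x)) := fun x => by
    rw [← hsup x]
    exact tendsto_atTop_iSup fun k l hkl => hmono hkl x
  have hstep : ∀ k, ∫⁻ ω, negExp (∑' l, f k (X ω l)) ∂P =
      negExp (lam * ∫⁻ x, (1 - negExp (f k x))) := fun k => by
    let A : (f k).range → Set Plane := fun a => f k ⁻¹' {a.1} ∩ Metric.ball 0 k
    have hA : ∀ a, MeasurableSet (A a) := fun a =>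
      ((f k).measurableSet_preimage _).inter (hball k)
    have hd : Pairwise fun a b => Disjoint (A a) (A b) := fun a b hab =>
      Set.disjoint_left.2 fun x ha hb => hab (Subtype.ext (ha.1.symm.trans hb.1))
    have key : ∀ (φ : ℝ≥0∞ → ℝ≥0∞), φ 0 = 0 → ∀ x,
        φ (f k x) = ∑ a, (A a).indicator (fun _ => φ a.1) x := fun φ h0 x => by
      by_cases hx : x ∈ Metric.ball (0 : Plane) k
      · rw [Finset.sum_eq_single ⟨f k x, (f k).mem_range_self x⟩]
        · rw [Set.indicator_of_mem]
          exact ⟨rfl, hx⟩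
        · intro a _ ha
          refine Set.indicator_of_notMem (fun hxa => ha ?_) _
          exact Subtype.ext (show a.1 = f k x from hxa.1.symm)
        · simp
      · have h0' : f k x = 0 := by rw [hfx, Set.indicator_of_notMem hx]
        rw [h0', h0]
        refine (Finset.sum_eq_zero fun a _ => Set.indicator_of_notMem (fun hxa => hx hxa.2) _).symm
    have e1 : ∀ x, f k x = ∑ a, (A a).indicator (fun _ => a.1) x := key id rfl
    have e2 : ∀ x, 1 - negExp (f k x) = ∑ a, (A a).indicator (fun _ => 1 - negExp a.1) x :=
      key (fun t => 1 - negExp t) (by simp)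
    simp_rw [e2]
    rw [lintegral_finsetSum _ (fun a _ => measurable_const.indicator (hA a))]
    simp_rw [lintegral_indicator_const (hA _)]
    rw [← h.lintegral_negExp_sum_indicator hX (fun a => a.1) hA
      (fun a => Metric.isBounded_ball.subset Set.inter_subset_right) hd]
    refine lintegral_congr fun ω => congrArg _ (tsum_congr fun l => e1 _)
  have hXl : ∀ l, Measurable fun ω => X ω l := fun l => (measurable_pi_apply l).comp hX
  have hL : Filter.Tendsto (fun k => ∫⁻ ω, negExp (∑' l, f k (X ω l)) ∂P) Filter.atTop
      (nhds (∫⁻ ω, negExp (∑' l, g (X ω l)) ∂P)) := by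
    refine tendsto_lintegral_of_dominated_convergence 1 (fun k => ?_) (fun k => ?_) (by simp) ?_
    · exact measurable_negExp.comp
        (Measurable.tsum fun l => (f k).measurable.comp (hXl l))
    · exact Filter.Eventually.of_forall fun ω => negExp_le_one _
    · refine Filter.Eventually.of_forall fun ω => (continuous_negExp.tendsto _).comp ?_
      have : ∑' l, g (X ω l) = ⨆ k, ∑' l, f k (X ω l) := by
        simp_rw [← hsup, ← lintegral_count]
        exact lintegral_iSup (fun k => measurable_from_top) fun k l hkl x => hmono hkl _
      rw [this]
      exact tendsto_atTop_iSup fun k l hkl => ENNReal.tsum_le_tsum fun i => hmono hkl _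
  have hR : Filter.Tendsto (fun k => negExp (lam * ∫⁻ x, (1 - negExp (f k x)))) Filter.atTop
      (nhds (negExp (lam * ∫⁻ x, (1 - negExp (g x))))) := by
    refine (continuous_negExp.tendsto _).comp ?_
    refine ENNReal.Tendsto.const_mul ?_ (Or.inr ENNReal.coe_ne_top)
    refine lintegral_tendsto_of_tendsto_of_monotone (fun k => ?_) ?_ ?_
    · exact (measurable_const.sub (measurable_negExp.comp (f k).measurable)).aemeasurable
    · exact Filter.Eventually.of_forall fun x k l hkl =>
        tsub_le_tsub_left (antitone_negExp (hmono hkl x)) 1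
    · refine Filter.Eventually.of_forall fun x => ?_
      exact ENNReal.Tendsto.sub tendsto_const_nhds
        ((continuous_negExp.tendsto _).comp (htend x)) (Or.inl (by simp))
  simp_rw [hstep] at hL
  exact tendsto_nhds_unique hL hR

end IsHomogeneousPPP

/-! ### Unit-mean exponential coefficients -/

instance isProbabilityMeasure_expMeasure_one : IsProbabilityMeasure (expMeasure 1) :=
  isProbabilityMeasure_expMeasure one_pos

lemma lintegral_expMeasure_one {f : ℝ → ℝ≥0∞} (hf : Measurable f) :
    ∫⁻ x, f x ∂(expMeasure 1) = ∫⁻ x in Set.Ioi 0, ENNReal.ofReal (Real.exp (-x)) * f x := by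
  have hm : Measurable (exponentialPDF 1) := (measurable_exponentialPDFReal 1).ennreal_ofReal
  have h1 : expMeasure 1 = volume.withDensity (exponentialPDF 1) := rfl
  rw [h1, lintegral_withDensity_eq_lintegral_mul _ hm hf, ← lintegral_indicator measurableSet_Ioi]
  refine lintegral_congr_ae ?_
  filter_upwards [Measure.ae_ne volume (0 : ℝ)] with x hx
  rcases lt_or_gt_of_ne hx with h | h
  · rw [Set.indicator_of_notMem (by simpa using h.le), Pi.mul_apply, exponentialPDF_of_neg h,
      zero_mul]
  · rw [Set.indicator_of_mem (by simpa using h), Pi.mul_apply, exponentialPDF_of_nonneg h.le]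
    simp

lemma ae_pos_expMeasure_one : ∀ᵐ x ∂(expMeasure 1), 0 < x := by
  have h : MeasurableSet {x : ℝ | ¬ 0 < x} :=
    (measurableSet_lt measurable_const measurable_id).compl
  rw [ae_iff, ← lintegral_indicator_one h,
    lintegral_expMeasure_one (measurable_one.indicator h)]
  refine (setLIntegral_congr_fun measurableSet_Ioi fun x hx => ?_).trans lintegral_zero
  simp [show 0 < x from hx]

lemma lintegral_exp_neg_mul_Ioi {a : ℝ} (ha : 0 < a) (c : ℝ) :
    ∫⁻ x in Set.Ioi c, ENNReal.ofReal (Real.exp (-(a * x))) =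
      ENNReal.ofReal (Real.exp (-(a * c)) / a) := by
  have hi := integrableOn_exp_mul_Ioi (neg_lt_zero.2 ha) c
  have hv := integral_exp_mul_Ioi (neg_lt_zero.2 ha) c
  simp only [neg_mul] at hi hv
  rw [← ofReal_integral_eq_lintegral_ofReal hi
    (Filter.Eventually.of_forall fun x => (Real.exp_pos _).le), hv, neg_div_neg_eq]

/-- The Laplace transform of a unit-mean exponential variable. -/
lemma lintegral_negExp_expMeasure_one {t : ℝ} (ht : 0 ≤ t) :
    ∫⁻ x, negExp (ENNReal.ofReal (t * x)) ∂(expMeasure 1) = ENNReal.ofReal (1 / (1 + t)) := by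
  have h := lintegral_exp_neg_mul_Ioi (show 0 < 1 + t by linarith) 0
  rw [mul_zero, neg_zero, Real.exp_zero] at h
  rw [lintegral_expMeasure_one (by fun_prop), ← h]
  refine setLIntegral_congr_fun measurableSet_Ioi fun x (hx : 0 < x) => ?_
  rw [negExp_ofReal (by positivity), ← ENNReal.ofReal_mul (Real.exp_pos _).le, ← Real.exp_add]
  congr 2; ring

lemma expMeasure_one_Ici {a : ℝ} (ha : 0 ≤ a) :
    expMeasure 1 (Set.Ici a) = ENNReal.ofReal (Real.exp (-a)) := by
  have h := lintegral_exp_neg_mul_Ioi one_pos a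
  simp only [one_mul, div_one] at h
  rw [← lintegral_indicator_one measurableSet_Ici,
    lintegral_expMeasure_one (measurable_one.indicator measurableSet_Ici), ← h,
    ← lintegral_indicator measurableSet_Ioi, ← lintegral_indicator measurableSet_Ioi]
  refine lintegral_congr_ae ?_
  filter_upwards [Measure.ae_ne volume a] with x hx
  by_cases hxa : a < x
  · simp [Set.indicator, hxa, ha.trans_lt hxa, hxa.le]
  · have : ¬ a ≤ x := fun h => hxa (lt_of_le_of_ne h hx.symm)
    simp [Set.indicator, hxa, this]

lemma expMeasure_one_Ico {a : ℝ} (ha : 0 ≤ a) (b : ℝ) :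
    expMeasure 1 (Set.Ico a b) = ENNReal.ofReal (Real.exp (-a) - Real.exp (-b)) := by
  rcases le_total a b with h | h
  · rw [← Set.Ici_sdiff_Ici, measure_sdiff (Set.Ici_subset_Ici.2 h)
      measurableSet_Ici.nullMeasurableSet (measure_ne_top _ _), expMeasure_one_Ici ha,
      expMeasure_one_Ici (ha.trans h), ENNReal.ofReal_sub _ (Real.exp_pos _).le]
  · rw [Set.Ico_eq_empty (not_lt.2 h), measure_empty, ENNReal.ofReal_of_nonpos]
    simpa using h

lemma expMeasure_one_singleton (a : ℝ) : expMeasure 1 {a} = 0 := by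
  rw [← lintegral_indicator_one (measurableSet_singleton a),
    lintegral_expMeasure_one (measurable_one.indicator (measurableSet_singleton a)),
    ← lintegral_indicator measurableSet_Ioi]
  refine (lintegral_congr_ae ?_).trans lintegral_zero
  filter_upwards [Measure.ae_ne volume a] with x hx
  simp [Set.indicator, hx]

/-! ### Success probabilities given the interference -/

/-- The law of two independent unit-mean exponential coefficients. -/
noncomputable abbrev expPair : Measure (ℝ × ℝ) := (expMeasure 1).prod (expMeasure 1)

lemma ae_expPair : ∀ᵐ p ∂expPair, 0 < p.1 ∧ 0 < p.2 ∧ p.1 ≠ p.2 := by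
  have h1 : ∀ᵐ p ∂expPair, 0 < p.1 := Measure.quasiMeasurePreserving_fst.ae ae_pos_expMeasure_one
  have h2 : ∀ᵐ p ∂expPair, 0 < p.2 := Measure.quasiMeasurePreserving_snd.ae ae_pos_expMeasure_one
  have h3 : ∀ᵐ p ∂expPair, p.1 ≠ p.2 := by
    have hm : MeasurableSet {p : ℝ × ℝ | ¬ p.1 ≠ p.2} := by
      simpa using measurableSet_eq_fun measurable_fst measurable_snd
    rw [ae_iff, Measure.prod_apply hm]
    refine (lintegral_congr fun x => ?_).trans lintegral_zero
    convert! expMeasure_one_singleton x using 2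
    ext y
    simp [eq_comm]
  filter_upwards [h1, h2, h3] with p a b c using ⟨a, b, c⟩

lemma expPair_real_affine_le {c κ : ℝ} (hc : 0 ≤ c) (hκ : 0 ≤ κ) :
    expPair.real {p | c + κ * p.1 ≤ p.2} = Real.exp (-c) / (1 + κ) := by
  have hm : MeasurableSet {p : ℝ × ℝ | c + κ * p.1 ≤ p.2} :=
    measurableSet_le (by fun_prop) (by fun_prop)
  rw [Measure.real, Measure.prod_apply hm]
  have h : ∫⁻ y, expMeasure 1 (Prod.mk y ⁻¹' {p : ℝ × ℝ | c + κ * p.1 ≤ p.2}) ∂(expMeasure 1) =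
      ∫⁻ y, ENNReal.ofReal (Real.exp (-c)) * negExp (ENNReal.ofReal (κ * y)) ∂(expMeasure 1) := by
    refine lintegral_congr_ae ?_
    filter_upwards [ae_pos_expMeasure_one] with y hy
    rw [negExp_ofReal (by positivity), ← ENNReal.ofReal_mul (Real.exp_pos _).le, ← Real.exp_add,
      ← neg_add]
    exact expMeasure_one_Ici (a := c + κ * y) (by positivity)
  rw [h, lintegral_const_mul _ (by fun_prop),
    lintegral_negExp_expMeasure_one hκ, ← ENNReal.ofReal_mul (Real.exp_pos _).le,
    ENNReal.toReal_ofReal (by positivity)]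
  ring

lemma measurableSet_affine_le_lt (c κ : ℝ) :
    MeasurableSet {p : ℝ × ℝ | c + κ * p.1 ≤ p.2 ∧ p.2 < p.1} := by
  have h : MeasurableSet {p : ℝ × ℝ | c + κ * p.1 ≤ p.2} :=
    measurableSet_le (by fun_prop) (by fun_prop)
  exact h.inter (measurableSet_lt measurable_snd measurable_fst)

/-- The probability that the smaller coefficient is the second one and exceeds an affine function
of the larger one. Both success probabilities for two devices reduce to it. -/
lemma expPair_real_affine_le_lt {c κ : ℝ} (hc : 0 ≤ c) (hκ : 0 ≤ κ) :
    expPair.real {p | c + κ * p.1 ≤ p.2 ∧ p.2 < p.1} =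
      if κ < 1 then (1 - κ) / (2 * (1 + κ)) * Real.exp (-(2 * c / (1 - κ))) else 0 := by
  have hm := measurableSet_affine_le_lt c κ
  split_ifs with h1
  · have hk : 0 < 1 - κ := by linarith
    have h : ∫⁻ y, expMeasure 1 (Prod.mk y ⁻¹' {p : ℝ × ℝ | c + κ * p.1 ≤ p.2 ∧ p.2 < p.1})
        ∂(expMeasure 1) =
        ∫⁻ y, ENNReal.ofReal (Real.exp (-(c + κ * y)) - Real.exp (-y)) ∂(expMeasure 1) := by
      refine lintegral_congr_ae ?_
      filter_upwards [ae_pos_expMeasure_one] with y hy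
      exact expMeasure_one_Ico (a := c + κ * y) (by positivity) y
    -- The integrand vanishes up to the point where the affine function meets the diagonal.
    set y₀ := c / (1 - κ) with hy₀
    have hcy : c = (1 - κ) * y₀ := by rw [hy₀]; field_simp
    have hy₀' : 0 ≤ y₀ := by positivity
    have h2 : ∫⁻ y in Set.Ioi 0, ENNReal.ofReal (Real.exp (-y)) *
          ENNReal.ofReal (Real.exp (-(c + κ * y)) - Real.exp (-y)) =
        ∫⁻ y in Set.Ioi y₀, ENNReal.ofReal
          (Real.exp (-c) * Real.exp (-(1 + κ) * y) - Real.exp (-2 * y)) := by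
      rw [← lintegral_indicator measurableSet_Ioi, ← lintegral_indicator measurableSet_Ioi]
      refine lintegral_congr fun y => ?_
      by_cases hy : y₀ < y
      · rw [Set.indicator_of_mem (by simpa using hy₀'.trans_lt hy), Set.indicator_of_mem
          (by simpa using hy), ← ENNReal.ofReal_mul (Real.exp_pos _).le, mul_sub,
          ← Real.exp_add, ← Real.exp_add, ← Real.exp_add]
        have e1 : -y + -(c + κ * y) = -c + -(1 + κ) * y := by ring
        have e2 : -y + -y = -2 * y := by ring
        rw [e1, e2]
      · rw [Set.indicator_of_notMem (s := Set.Ioi y₀) (by simpa using hy)]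
        by_cases hy0 : 0 < y
        · rw [Set.indicator_of_mem (by simpa using hy0), ENNReal.ofReal_of_nonpos (p := _ - _),
            mul_zero]
          rw [sub_nonpos]
          apply Real.exp_le_exp.2
          nlinarith
        · rw [Set.indicator_of_notMem (by simpa using hy0)]
    have ia := (integrableOn_exp_mul_Ioi (show -(1 + κ) < 0 by linarith) y₀).const_mul
      (Real.exp (-c))
    have ib := integrableOn_exp_mul_Ioi (show (-2 : ℝ) < 0 by norm_num) y₀
    have iab : Integrable (fun y => Real.exp (-c) * Real.exp (-(1 + κ) * y) - Real.exp (-2 * y))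
        (volume.restrict (Set.Ioi y₀)) := ia.sub ib
    rw [Measure.real, Measure.prod_apply hm, h, lintegral_expMeasure_one (by fun_prop), h2,
      ← ofReal_integral_eq_lintegral_ofReal iab, integral_sub ia ib, integral_const_mul,
      integral_exp_mul_Ioi (by linarith), integral_exp_mul_Ioi (by norm_num)]
    · have e1 : Real.exp (-c) * (-Real.exp (-(1 + κ) * y₀) / -(1 + κ)) -
          -Real.exp (-2 * y₀) / -2 = (1 - κ) / (2 * (1 + κ)) * Real.exp (-2 * y₀) := by
        have : Real.exp (-c) * (-Real.exp (-(1 + κ) * y₀) / -(1 + κ)) =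
            Real.exp (-2 * y₀) / (1 + κ) := by
          rw [neg_div_neg_eq, ← mul_div_assoc, ← Real.exp_add]
          congr 2
          rw [hcy]; ring
        rw [this]
        field_simp
        ring
      rw [e1, ENNReal.toReal_ofReal (by positivity)]
      congr 2
      rw [hy₀]; ring
    · refine (ae_restrict_iff' measurableSet_Ioi).2 (Filter.Eventually.of_forall fun y hy => ?_)
      have hy' : y₀ < y := hy
      rw [Pi.zero_apply, sub_nonneg, ← Real.exp_add]
      apply Real.exp_le_exp.2
      nlinarith
  · have : expPair {p | c + κ * p.1 ≤ p.2 ∧ p.2 < p.1} = 0 := by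
      rw [measure_eq_zero_iff_ae_notMem]
      filter_upwards [ae_expPair] with p hp h
      have h' : c + κ * p.1 ≤ p.2 ∧ p.2 < p.1 := h
      nlinarith [hp.1, not_lt.1 h1]
    simp [Measure.real, this]

/-- A symmetric event has twice the probability of its part above the diagonal. -/
lemma expPair_real_eq_two_mul {S T : Set (ℝ × ℝ)} (hT : MeasurableSet T)
    (h : ∀ᵐ p ∂expPair, p ∈ S ↔ p ∈ T ∨ p.swap ∈ T) (hd : ∀ p ∈ T, p.swap ∉ T) :
    expPair.real S = 2 * expPair.real T := by
  have h1 : expPair.real S = expPair.real (T ∪ Prod.swap ⁻¹' T) := by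
    refine measureReal_congr ?_
    filter_upwards [h] with p hp
    exact propext hp
  have h2 : expPair.real (Prod.swap ⁻¹' T) = expPair.real T := by
    rw [Measure.real, Measure.real, ← Measure.map_apply measurable_swap hT, Measure.prod_swap]
  rw [h1, measureReal_union (s₂ := Prod.swap ⁻¹' T) (Set.disjoint_left.2 hd)
    (measurable_swap hT), h2]
  ring

lemma ofReal_le_ofReal_div_iff {θ b c : ℝ} {I : ℝ≥0∞} (hθ : 0 ≤ θ) (hb : 0 < b) (hc : 0 ≤ c)
    (hI : I ≠ ∞) :
    ENNReal.ofReal θ ≤ ENNReal.ofReal b / (I + ENNReal.ofReal c) ↔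
      θ * I.toReal + θ * c ≤ b := by
  have hb' : ENNReal.ofReal b ≠ 0 := by simpa using hb
  rw [ENNReal.le_div_iff_mul_le (Or.inr hb') (Or.inr ENNReal.ofReal_ne_top)]
  have : I + ENNReal.ofReal c = ENNReal.ofReal (I.toReal + c) := by
    rw [ENNReal.ofReal_add ENNReal.toReal_nonneg hc, ENNReal.ofReal_toReal hI]
  rw [this, ← ENNReal.ofReal_mul hθ, ENNReal.ofReal_le_ofReal_iff hb.le, mul_add]

lemma expMeasure_real_le_sir₁₁ {θ : ℝ} {I : ℝ≥0∞} (hθ : 0 ≤ θ) (hI : I ≠ ∞) :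
    (expMeasure 1).real {h | ENNReal.ofReal θ ≤ sir₁₁ h I} = Real.exp (-(θ * I.toReal)) := by
  have h1 : (expMeasure 1).real {h | ENNReal.ofReal θ ≤ sir₁₁ h I} =
      (expMeasure 1).real (Set.Ici (θ * I.toReal)) := by
    refine measureReal_congr ?_
    filter_upwards [ae_pos_expMeasure_one] with x hx
    refine propext ?_
    have := ofReal_le_ofReal_div_iff (c := 0) hθ hx le_rfl hI
    rw [ENNReal.ofReal_zero, add_zero, mul_zero, add_zero] at this
    exact this
  rw [h1, Measure.real, expMeasure_one_Ici (by positivity),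
    ENNReal.toReal_ofReal (Real.exp_pos _).le]

lemma expPair_real_le_sir₁₂ {θ : ℝ} {I : ℝ≥0∞} (hθ : 0 ≤ θ) (hI : I ≠ ∞) :
    expPair.real {p | ENNReal.ofReal θ ≤ sir₁₂ p.1 p.2 I} =
      if θ < 1 then 2 / (1 + θ) * Real.exp (-(θ * I.toReal))
          - (1 - θ) / (1 + θ) * Real.exp (-(2 * θ / (1 - θ) * I.toReal))
        else 2 / (1 + θ) * Real.exp (-(θ * I.toReal)) := by
  have hc : 0 ≤ θ * I.toReal := by positivity
  set c := θ * I.toReal with hcdef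
  have hD : MeasurableSet {p : ℝ × ℝ | c + θ * p.1 ≤ p.2} :=
    measurableSet_le (by fun_prop) (by fun_prop)
  have hG := measurableSet_affine_le_lt c θ
  have hT : MeasurableSet {p : ℝ × ℝ | c + θ * p.1 ≤ p.2 ∧ p.1 < p.2} :=
    hD.inter (measurableSet_lt measurable_fst measurable_snd)
  rw [expPair_real_eq_two_mul (T := {p | c + θ * p.1 ≤ p.2 ∧ p.1 < p.2}) hT]
  · have hsub : expPair.real {p | c + θ * p.1 ≤ p.2 ∧ p.1 < p.2} =
        expPair.real {p | c + θ * p.1 ≤ p.2} -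
          expPair.real {p | c + θ * p.1 ≤ p.2 ∧ p.2 < p.1} := by
      have hGD : {p : ℝ × ℝ | c + θ * p.1 ≤ p.2 ∧ p.2 < p.1} ⊆ {p | c + θ * p.1 ≤ p.2} :=
        fun p hp => hp.1
      rw [← measureReal_sdiff hGD hG]
      refine measureReal_congr ?_
      filter_upwards [ae_expPair] with p hp
      refine propext ⟨fun h => ⟨h.1, fun h' => lt_asymm h.2 h'.2⟩, fun h => ⟨h.1, ?_⟩⟩
      exact lt_of_le_of_ne (not_lt.1 fun h' => h.2 ⟨h.1, h'⟩) hp.2.2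
    rw [hsub, expPair_real_affine_le hc hθ, expPair_real_affine_le_lt hc hθ]
    split_ifs with h1
    · have e : 2 * c / (1 - θ) = 2 * θ / (1 - θ) * I.toReal := by rw [hcdef]; ring
      rw [e]
      field_simp
    · field_simp
      ring
  · filter_upwards [ae_expPair] with p hp
    rw [sir₁₂, ofReal_le_ofReal_div_iff hθ (lt_max_of_lt_left hp.1) (le_min hp.1.le hp.2.1.le) hI]
    rcases lt_or_gt_of_ne hp.2.2 with h | h
    · simp [h, h.le, hcdef]
    · simp [h, h.le, hcdef]
  · exact fun p hp hp' => lt_asymm hp.2 hp'.2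

lemma expPair_real_le_sir₂₂ {θ μ : ℝ} {I : ℝ≥0∞} (hθ : 0 ≤ θ) (hμ : 0 ≤ μ) (hI : I ≠ ∞) :
    expPair.real {p | ENNReal.ofReal θ ≤ sir₂₂ μ p.1 p.2 I} =
      if θ * μ < 1 then
          (1 - θ * μ) / (1 + θ * μ) * Real.exp (-(2 * θ / (1 - θ * μ) * I.toReal))
        else 0 := by
  have hc : 0 ≤ θ * I.toReal := by positivity
  set c := θ * I.toReal with hcdef
  have hG := measurableSet_affine_le_lt c (θ * μ)
  rw [expPair_real_eq_two_mul hG]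
  · rw [expPair_real_affine_le_lt hc (mul_nonneg hθ hμ)]
    split_ifs with h1
    · have e : 2 * c / (1 - θ * μ) = 2 * θ / (1 - θ * μ) * I.toReal := by rw [hcdef]; ring
      rw [e]
      have : 0 < 1 + θ * μ := by positivity
      field_simp
    · simp
  · filter_upwards [ae_expPair] with p hp
    rw [sir₂₂, ofReal_le_ofReal_div_iff hθ (lt_min hp.1 hp.2.1)
      (mul_nonneg hμ (hp.1.le.trans (le_max_left _ _))) hI, ← mul_assoc]
    rcases lt_or_gt_of_ne hp.2.2 with h | h
    · simp [h, h.le, hcdef]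
    · simp [h, h.le, hcdef]
  · exact fun p hp hp' => lt_asymm hp.2 hp'.2
/-! ### The schedule of one cluster -/

instance (N L : ℕ) : DiscreteMeasurableSpace (Schedule N L) := ⟨fun _ => trivial⟩

instance (m : ℝ≥0) (N L : ℕ) : IsProbabilityMeasure (scheduleLaw m N L) := by
  unfold scheduleLaw; infer_instance

lemma Schedule.mem_onChannel {N L : ℕ} (a : Schedule N L) (n : Fin N) (j : ℕ) :
    j ∈ a.onChannel n ↔ ∃ h : j < a.1, ∃ (l : Fin L) (c : Fin N),
      (a.2.1 ⟨j, h⟩ : ℕ) = l * N + c ∧ a.2.2 l c = n := by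
  simp only [Schedule.onChannel, Finset.mem_map, Finset.mem_filter, Finset.mem_univ, true_and,
    Fin.valEmbedding_apply]
  constructor
  · rintro ⟨i, h, rfl⟩
    exact ⟨i.2, h⟩
  · rintro ⟨hj, h⟩
    exact ⟨⟨j, hj⟩, h, rfl⟩

/-- Each round allocates at most one device to a given channel. -/
lemma Schedule.card_onChannel_le {N L : ℕ} (a : Schedule N L) (n : Fin N) :
    (a.onChannel n).card ≤ L := by
  have h : ∀ j ∈ a.onChannel n, ∃ l : Fin L, ∃ c : Fin N, ∃ h : j < a.1,
      (a.2.1 ⟨j, h⟩ : ℕ) = l * N + c ∧ a.2.2 l c = n := fun j hj => by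
    obtain ⟨h, l, c, h1⟩ := (a.mem_onChannel n j).1 hj
    exact ⟨l, c, h, h1⟩
  choose f hf using h
  have hinj : Function.Injective fun j : a.onChannel n => f j.1 j.2 := by
    rintro ⟨i, hi⟩ ⟨j, hj⟩ (hij : f i hi = f j hj)
    obtain ⟨c, h, h1, h2⟩ := hf i hi
    obtain ⟨c', h', h1', h2'⟩ := hf j hj
    rw [← hij] at h1' h2'
    have hc : c = c' := (a.2.2 (f i hi)).injective (h2.trans h2'.symm)
    have : a.2.1 ⟨i, h⟩ = a.2.1 ⟨j, h'⟩ := Fin.ext (by rw [h1, h1', hc])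
    simpa using a.2.1.injective this
  simpa using Fintype.card_le_of_injective _ hinj

lemma scheduleLaw_singleton_ne_zero {m : ℝ≥0} (hm : 0 < m) {N L : ℕ} (a : Schedule N L) :
    scheduleLaw m N L {a} ≠ 0 := by
  obtain ⟨k, x⟩ := a
  refine (PMF.toMeasure_apply_singleton _ _ (measurableSet_singleton _)).trans_ne ?_
  refine (PMF.mem_support_iff _ _).1 ((PMF.mem_support_bind_iff _ _ _).2 ⟨k, ?_, ?_⟩)
  · rw [PMF.mem_support_iff, Measure.toPMF_apply, poissonMeasure_singleton]
    have : 0 < Real.exp (-(m : ℝ)) * (m : ℝ) ^ k / k.factorial := by positivity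
    simpa using this
  · exact (PMF.mem_support_map_iff _ _ _).2 ⟨x, by simp, rfl⟩

/-- With positive probability exactly one device is on a given channel. -/
lemma scheduleLaw_card_eq_one_ne_zero {m : ℝ≥0} (hm : 0 < m) {N L : ℕ} (hL : 1 ≤ L) (n : Fin N) :
    scheduleLaw m N L {a | (a.onChannel n).card = 1} ≠ 0 := by
  -- a single device, matched with the channel `n` in the first round
  let a : Schedule N L := ⟨1, Equiv.refl _, fun _ => Equiv.swap ⟨0, n.pos⟩ n⟩
  have ha : a.onChannel n = {0} := by
    ext j
    rw [Schedule.mem_onChannel, Finset.mem_singleton]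
    constructor
    · rintro ⟨h, -⟩
      have h' : j < 1 := h
      omega
    · rintro rfl
      exact ⟨Nat.one_pos, ⟨0, hL⟩, ⟨0, n.pos⟩, by simp [a], by simp [a]⟩
  refine fun h => scheduleLaw_singleton_ne_zero hm a (measure_mono_null ?_ h)
  rw [Set.singleton_subset_iff, Set.mem_ofPred_eq, ha, Finset.card_singleton]

/-- With positive probability exactly two devices share a given channel. -/
lemma scheduleLaw_card_eq_two_ne_zero {m : ℝ≥0} (hm : 0 < m) {N L : ℕ} (hL : 2 ≤ L) (n : Fin N) :
    scheduleLaw m N L {a | (a.onChannel n).card = 2} ≠ 0 := by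
  -- `N + 1` devices served in the order of their numbers, where the channel `n` is matched with
  -- the first place of each round
  let a : Schedule N L := ⟨N + 1, Equiv.refl _, fun _ => Equiv.swap ⟨0, n.pos⟩ n⟩
  have ha : a.onChannel n = {0, N} := by
    ext j
    rw [Schedule.mem_onChannel, Finset.mem_insert, Finset.mem_singleton]
    constructor
    · rintro ⟨h, l, c, h1, h2⟩
      have h' : j < N + 1 := h
      have h1' : j = l * N + c := h1
      have hc : c = ⟨0, n.pos⟩ := (Equiv.swap (⟨0, n.pos⟩ : Fin N) n).injective
        (h2.trans (Equiv.swap_apply_left _ n).symm)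
      rw [hc] at h1'
      rcases Nat.lt_or_ge (l : ℕ) 2 with hl | hl
      · interval_cases hl' : (l : ℕ) <;> simp_all
      · have : 2 * N ≤ l * N := Nat.mul_le_mul_right _ hl
        have := n.pos
        simp only [add_zero] at h1'
        omega
    · rintro (rfl | rfl)
      · exact ⟨Nat.succ_pos _, ⟨0, by omega⟩, ⟨0, n.pos⟩, by simp [a], by simp [a]⟩
      · exact ⟨Nat.lt_succ_self _, ⟨1, by omega⟩, ⟨0, n.pos⟩, by simp [a], by simp [a]⟩
  refine fun h => scheduleLaw_singleton_ne_zero hm a (measure_mono_null ?_ h)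
  rw [Set.singleton_subset_iff, Set.mem_ofPred_eq, ha, Finset.card_pair n.pos.ne]

lemma lintegral_scheduleLaw_pow_card (m : ℝ≥0) (N L : ℕ) (n : Fin N) (y : ℝ≥0∞) :
    ∫⁻ a, y ^ (a.onChannel n).card ∂(scheduleLaw m N L) =
      ∑ u ∈ Finset.range (L + 1), ENNReal.ofReal (channelPMF m N L n u) * y ^ u := by
  have hc : Measurable fun a : Schedule N L => (a.onChannel n).card := measurable_from_top
  have h1 : ∫⁻ a, y ^ (a.onChannel n).card ∂(scheduleLaw m N L) =
      ∫⁻ u : ℕ, y ^ u ∂((scheduleLaw m N L).map fun a => (a.onChannel n).card) := by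
    rw [lintegral_map (f := fun u : ℕ => y ^ u) measurable_from_nat hc]
  have h2 : ∀ u : ℕ, (scheduleLaw m N L).map (fun a => (a.onChannel n).card) {u} =
      scheduleLaw m N L {a | (a.onChannel n).card = u} := fun u => by
    rw [Measure.map_apply hc (measurableSet_singleton _)]
    rfl
  rw [h1, lintegral_countable', tsum_eq_sum (s := Finset.range (L + 1))]
  · refine Finset.sum_congr rfl fun u _ => ?_
    rw [h2, channelPMF, ofReal_measureReal, mul_comm]
  · intro u hu
    rw [h2]
    have : {a : Schedule N L | (a.onChannel n).card = u} = ∅ := by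
      refine Set.eq_empty_iff_forall_notMem.2 fun a ha => hu ?_
      have := a.card_onChannel_le n
      have ha' : (a.onChannel n).card = u := ha
      simp only [Finset.mem_range]
      omega
    rw [this, measure_empty, mul_zero]

/-! ### The interference of one cluster -/

/-- The law of a device: displacement uniform on the disk and exponential coefficient. -/
noncomputable abbrev deviceLaw (R : ℝ) : Measure (Plane × ℝ) :=
  (cond (volume : Measure Plane) (Metric.closedBall 0 R)).prod (expMeasure 1)

lemma isProbabilityMeasure_cond_closedBall {R : ℝ} (hR : 0 < R) :
    IsProbabilityMeasure (cond (volume : Measure Plane) (Metric.closedBall 0 R)) := by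
  refine cond_isProbabilityMeasure_of_finite ?_ measure_closedBall_lt_top.ne
  exact (Metric.measure_closedBall_pos _ _ hR).ne'

lemma isProbabilityMeasure_clusterLaw (m : ℝ≥0) {R : ℝ} (hR : 0 < R) (N L : ℕ) :
    IsProbabilityMeasure (clusterLaw m R N L) := by
  have := isProbabilityMeasure_cond_closedBall hR
  unfold clusterLaw
  infer_instance

/-- The interference at the origin caused by a cluster with mark `b` around an aggregator
at `x`. -/
noncomputable def clusterInterference {N L : ℕ} (α : ℝ) (n : Fin N) (x : Plane)
    (b : ClusterMark N L) : ℝ≥0∞ :=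
  ∑ j ∈ b.1.onChannel n, ENNReal.ofReal ((b.2 j).2 * ‖(b.2 j).1‖ ^ α * ‖x + (b.2 j).1‖ ^ (-α))

lemma measurable_clusterInterference {N L : ℕ} (α : ℝ) (n : Fin N) :
    Measurable fun p : Plane × ClusterMark N L => clusterInterference α n p.1 p.2 := by
  have h : ∀ p : Plane × ClusterMark N L, clusterInterference α n p.1 p.2 =
      ∑' j, if j ∈ p.2.1.onChannel n then
        ENNReal.ofReal ((p.2.2 j).2 * ‖(p.2.2 j).1‖ ^ α * ‖p.1 + (p.2.2 j).1‖ ^ (-α)) else 0 := by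
    intro p
    rw [tsum_eq_sum (s := p.2.1.onChannel n) fun j hj => if_neg hj]
    exact Finset.sum_congr rfl fun j hj => (if_pos hj).symm
  simp_rw [h]
  refine Measurable.tsum fun j => Measurable.ite ?_ (by fun_prop) measurable_const
  have : Measurable fun p : Plane × ClusterMark N L => p.2.1 := by fun_prop
  exact this (MeasurableSet.of_discrete (s := {a : Schedule N L | j ∈ a.onChannel n}))

@[fun_prop]
lemma Measurable.clusterInterference {β : Type*} [MeasurableSpace β] {N L : ℕ} (α : ℝ) (n : Fin N)
    {x : β → Plane} {b : β → ClusterMark N L} (hx : Measurable x) (hb : Measurable b) :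
    Measurable fun y => _root_.clusterInterference α n (x y) (b y) := by
  have := (measurable_clusterInterference (L := L) α n).comp (hx.prodMk hb)
  exact this

/-- The Laplace transform at `s` of the interference of a single device that belongs to an
aggregator at `x`. -/
noncomputable def deviceLaplace (R α s : ℝ) (x : Plane) : ℝ≥0∞ :=
  ∫⁻ d, ENNReal.ofReal (1 / (1 + s * ‖d‖ ^ α * ‖x + d‖ ^ (-α)))
    ∂(cond (volume : Measure Plane) (Metric.closedBall 0 R))

lemma lintegral_negExp_deviceLaw {R : ℝ} (α : ℝ) {s : ℝ} (hs : 0 ≤ s) (x : Plane) :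
    ∫⁻ q, negExp (ENNReal.ofReal s *
        ENNReal.ofReal (q.2 * ‖q.1‖ ^ α * ‖x + q.1‖ ^ (-α))) ∂(deviceLaw R) =
      deviceLaplace R α s x := by
  rw [lintegral_prod _ (by fun_prop)]
  refine lintegral_congr fun d => ?_
  rw [← lintegral_negExp_expMeasure_one (by positivity)]
  refine lintegral_congr fun g => ?_
  rw [← ENNReal.ofReal_mul hs]
  congr 2
  ring

/-- The Laplace transform at `s` of the interference of a cluster around an aggregator at `x`. -/
noncomputable def clusterLaplace (m : ℝ≥0) (R α : ℝ) (N L : ℕ) (n : Fin N) (s : ℝ) (x : Plane) :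
    ℝ≥0∞ :=
  ∫⁻ b, negExp (ENNReal.ofReal s * clusterInterference α n x b) ∂(clusterLaw m R N L)

lemma clusterLaplace_eq_sum (m : ℝ≥0) {R : ℝ} (hR : 0 < R) (α : ℝ) (N L : ℕ) (n : Fin N) {s : ℝ}
    (hs : 0 ≤ s) (x : Plane) :
    clusterLaplace m R α N L n s x = ∑ u ∈ Finset.range (L + 1),
      ENNReal.ofReal (channelPMF m N L n u) * deviceLaplace R α s x ^ u := by
  have := isProbabilityMeasure_cond_closedBall hR
  have hm : Measurable fun b : ClusterMark N L =>
      negExp (ENNReal.ofReal s * clusterInterference α n x b) := by fun_prop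
  rw [clusterLaplace, clusterLaw, lintegral_prod _ hm.aemeasurable,
    ← lintegral_scheduleLaw_pow_card]
  refine lintegral_congr fun a => ?_
  have hf : Measurable fun q : Plane × ℝ => negExp (ENNReal.ofReal s *
      ENNReal.ofReal (q.2 * ‖q.1‖ ^ α * ‖x + q.1‖ ^ (-α))) := by fun_prop
  have hind := iIndepFun_infinitePi (P := fun _ : ℕ => deviceLaw R)
    (X := fun _ q => negExp (ENNReal.ofReal s *
      ENNReal.ofReal (q.2 * ‖q.1‖ ^ α * ‖x + q.1‖ ^ (-α)))) (fun _ => hf)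
  simp only [clusterInterference, Finset.mul_sum, negExp_sum]
  rw [lintegral_prod_eq_prod_lintegral_of_indepFun _ _ hind
    (fun j => hf.comp (measurable_pi_apply j)), ← Finset.prod_const]
  refine Finset.prod_congr rfl fun j _ => ?_
  rw [← lintegral_negExp_deviceLaw α hs]
  exact (measurePreserving_eval_infinitePi (fun _ : ℕ => deviceLaw R) j).lintegral_comp hf
/-! ### The disk average in polar coordinates -/

/-- The law of cosines, in terms of the argument of the first vector. -/
lemma norm_add_polarCoord_symm_sq (w : ℂ) (r ω : ℝ) :
    ‖w + Complex.polarCoord.symm (r, ω)‖ ^ 2 =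
      ‖w‖ ^ 2 + r ^ 2 + 2 * ‖w‖ * r * Real.cos (ω - w.arg) := by
  have hre := Complex.norm_mul_cos_arg w
  have him := Complex.norm_mul_sin_arg w
  have h1 := Real.sin_sq_add_cos_sq ω
  have h2 := Complex.sq_norm w
  rw [Complex.normSq_apply] at h2
  rw [Complex.sq_norm, Complex.normSq_apply, Complex.polarCoord_symm_apply, Real.cos_sub, h2]
  simp only [Complex.add_re, Complex.add_im, Complex.mul_re, Complex.mul_im, Complex.ofReal_re,
    Complex.ofReal_im, Complex.I_re, Complex.I_im]
  linear_combination r ^ 2 * h1 - 2 * r * Real.cos ω * hre - 2 * r * Real.sin ω * him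

/-- The angular integral does not depend on the direction of the aggregator. -/
lemma intervalIntegral_angle (α s r : ℝ) (w : ℂ) :
    ∫ ω in (-Real.pi)..Real.pi,
        r / (1 + s * r ^ α * ‖w + Complex.polarCoord.symm (r, ω)‖ ^ (-α)) =
      ∫ ω in (0 : ℝ)..(2 * Real.pi),
        r / (1 + s * r ^ α * (‖w‖ ^ 2 + r ^ 2 + 2 * ‖w‖ * r * Real.cos ω) ^ (-α / 2)) := by
  set f : ℝ → ℝ := fun ω =>
    r / (1 + s * r ^ α * (‖w‖ ^ 2 + r ^ 2 + 2 * ‖w‖ * r * Real.cos ω) ^ (-α / 2)) with hf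
  have hper : Function.Periodic f (2 * Real.pi) := fun ω => by
    simp only [hf, Real.cos_add_two_pi]
  have h1 : ∀ ω, r / (1 + s * r ^ α * ‖w + Complex.polarCoord.symm (r, ω)‖ ^ (-α)) =
      f (ω - w.arg) := fun ω => by
    simp only [hf]
    rw [← norm_add_polarCoord_symm_sq, ← Real.rpow_natCast, ← Real.rpow_mul (norm_nonneg _)]
    congr 4
    push_cast; ring
  simp_rw [h1]
  rw [intervalIntegral.integral_comp_sub_right f]
  have := hper.intervalIntegral_add_eq (-Real.pi - w.arg) 0
  rw [zero_add] at this
  rw [← this]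
  congr 1
  ring

lemma setIntegral_closedBall_eq {R α s : ℝ} (hR : 0 < R) (hs : 0 ≤ s) (x : Plane) :
    ∫ d in Metric.closedBall (0 : Plane) R, 1 / (1 + s * ‖d‖ ^ α * ‖x + d‖ ^ (-α)) =
      ∫ ra in (0 : ℝ)..R, ∫ ω in (0 : ℝ)..(2 * Real.pi),
        ra / (1 + s * ra ^ α *
          (‖x‖ ^ 2 + ra ^ 2 + 2 * ‖x‖ * ra * Real.cos ω) ^ (-α / 2)) := by
  let e := Complex.orthonormalBasisOneI.repr
  obtain ⟨w, rfl⟩ : ∃ w, x = e w := ⟨e.symm x, by simp⟩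
  have he : MeasurePreserving e volume volume :=
    Complex.orthonormalBasisOneI.measurePreserving_repr
  have hemb : MeasurableEmbedding e := e.toHomeomorph.measurableEmbedding
  rw [LinearIsometryEquiv.norm_map, ← integral_indicator measurableSet_closedBall,
    ← he.integral_comp hemb, ← Complex.integral_comp_polarCoord_symm, polarCoord_target,
    intervalIntegral.integral_of_le hR.le]
  set H : ℝ × ℝ → ℝ := fun p =>
    p.1 / (1 + s * p.1 ^ α * ‖w + Complex.polarCoord.symm p‖ ^ (-α)) with hH
  have hHm : Measurable H := by
    have : Measurable fun p : ℝ × ℝ => Complex.polarCoord.symm p := by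
      simp_rw [Complex.polarCoord_symm_apply]
      fun_prop
    fun_prop
  have h1 : ∀ p ∈ Set.Ioi (0 : ℝ) ×ˢ Set.Ioo (-Real.pi) Real.pi,
      p.1 • (Metric.closedBall (0 : Plane) R).indicator
        (fun d => 1 / (1 + s * ‖d‖ ^ α * ‖e w + d‖ ^ (-α))) (e (Complex.polarCoord.symm p)) =
      (Set.Ioc (0 : ℝ) R ×ˢ Set.Ioo (-Real.pi) Real.pi).indicator H p := by
    rintro p ⟨hp1, hp2⟩
    have hp1' : 0 < p.1 := hp1
    have hn : ‖e (Complex.polarCoord.symm p)‖ = p.1 := by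
      rw [LinearIsometryEquiv.norm_map, Complex.norm_polarCoord_symm, abs_of_pos hp1']
    by_cases hpR : p.1 ≤ R
    · rw [Set.indicator_of_mem (by rw [mem_closedBall_zero_iff, hn]; exact hpR),
        Set.indicator_of_mem (show p ∈ Set.Ioc (0 : ℝ) R ×ˢ Set.Ioo (-Real.pi) Real.pi from
          ⟨⟨hp1', hpR⟩, hp2⟩), hn, ← map_add,
        LinearIsometryEquiv.norm_map, smul_eq_mul, mul_one_div]
    · rw [Set.indicator_of_notMem (by rw [mem_closedBall_zero_iff, hn]; exact hpR),
        Set.indicator_of_notMem (fun h => hpR h.1.2), smul_zero]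
  rw [setIntegral_congr_fun (measurableSet_Ioi.prod measurableSet_Ioo) h1,
    setIntegral_indicator (measurableSet_Ioc.prod measurableSet_Ioo), Set.inter_eq_right.2
      (Set.prod_mono Set.Ioc_subset_Ioi_self subset_rfl), Measure.volume_eq_prod,
    setIntegral_prod]
  · refine setIntegral_congr_fun measurableSet_Ioc fun r hr => ?_
    rw [← intervalIntegral_angle, intervalIntegral.integral_of_le (by linarith [Real.pi_pos]),
      integral_Ioc_eq_integral_Ioo]
  · refine Measure.integrableOn_of_bounded (M := R) ?_ hHm.aestronglyMeasurable ?_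
    · rw [Measure.prod_prod]
      simp [ENNReal.mul_eq_top]
    · refine (ae_restrict_iff' (measurableSet_Ioc.prod measurableSet_Ioo)).2
        (Filter.Eventually.of_forall fun p hp => ?_)
      have hp0 : 0 ≤ p.1 := hp.1.1.le
      have : 0 ≤ s * p.1 ^ α * ‖w + Complex.polarCoord.symm p‖ ^ (-α) := by positivity
      rw [Real.norm_of_nonneg (by positivity)]
      exact (div_le_self hp0 (by linarith)).trans hp.1.2

lemma deviceLaplace_le_one {R : ℝ} (hR : 0 < R) (α : ℝ) {s : ℝ} (hs : 0 ≤ s) (x : Plane) :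
    deviceLaplace R α s x ≤ 1 := by
  have := isProbabilityMeasure_cond_closedBall hR
  calc deviceLaplace R α s x
      ≤ ∫⁻ _, 1 ∂(cond (volume : Measure Plane) (Metric.closedBall 0 R)) := by
        refine lintegral_mono fun d => ENNReal.ofReal_le_one.2 (div_le_one_of_le₀ ?_ ?_)
        · have : 0 ≤ s * ‖d‖ ^ α * ‖x + d‖ ^ (-α) := by positivity
          linarith
        · positivity
    _ = 1 := by simp

lemma diskAverage_nonneg (R α : ℝ) (hR : 0 < R) {s rw : ℝ} (hs : 0 ≤ s) (hrw : 0 ≤ rw) :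
    0 ≤ diskAverage R α rw s := by
  refine mul_nonneg (by positivity) (intervalIntegral.integral_nonneg hR.le fun ra hra => ?_)
  refine intervalIntegral.integral_nonneg (by positivity) fun ω _ => ?_
  have h0 : 0 ≤ ra := hra.1
  have : 0 ≤ rw ^ 2 + ra ^ 2 + 2 * rw * ra * Real.cos ω := by
    nlinarith [Real.neg_one_le_cos ω, mul_nonneg hrw h0, sq_nonneg (rw - ra)]
  positivity

lemma deviceLaplace_eq_diskAverage {R : ℝ} (hR : 0 < R) (α : ℝ) {s : ℝ} (hs : 0 ≤ s)
    (x : Plane) : deviceLaplace R α s x = ENNReal.ofReal (diskAverage R α ‖x‖ s) := by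
  have := isProbabilityMeasure_cond_closedBall hR
  have hnn : ∀ d : Plane, 0 ≤ 1 / (1 + s * ‖d‖ ^ α * ‖x + d‖ ^ (-α)) := fun d => by positivity
  have hm : Measurable fun d : Plane => 1 / (1 + s * ‖d‖ ^ α * ‖x + d‖ ^ (-α)) := by fun_prop
  have hi : Integrable (fun d : Plane => 1 / (1 + s * ‖d‖ ^ α * ‖x + d‖ ^ (-α)))
      (cond (volume : Measure Plane) (Metric.closedBall 0 R)) := by
    refine Integrable.of_bound hm.aestronglyMeasurable 1 (Filter.Eventually.of_forall fun d => ?_)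
    rw [Real.norm_of_nonneg (hnn d)]
    have : 0 ≤ s * ‖d‖ ^ α * ‖x + d‖ ^ (-α) := by positivity
    exact div_le_one_of_le₀ (by linarith) (by linarith)
  rw [deviceLaplace, ← ofReal_integral_eq_lintegral_ofReal hi (Filter.Eventually.of_forall hnn),
    ProbabilityTheory.cond, integral_smul_measure, setIntegral_closedBall_eq hR hs, diskAverage,
    EuclideanSpace.volume_closedBall_fin_two, smul_eq_mul]
  congr 2
  rw [ENNReal.toReal_inv, ENNReal.toReal_mul, ENNReal.toReal_pow, ENNReal.toReal_ofReal hR.le,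
    ENNReal.toReal_ofReal Real.pi_pos.le, one_div, mul_comm]

/-! ### Decay of the Laplace transform of a far cluster -/

/-- Far from the origin the path loss of every device of a cluster is comparable to that of its
aggregator. -/
lemma one_sub_le_deviceLaplace {R α s : ℝ} (hR : 0 < R) (hα : 0 < α) (hs : 0 ≤ s) {x : Plane}
    (hx : 2 * R ≤ ‖x‖) :
    ENNReal.ofReal (1 - s * (1 + 2 * R) ^ α * (1 + ‖x‖) ^ (-α)) ≤ deviceLaplace R α s x := by
  have := isProbabilityMeasure_cond_closedBall hR
  set T := s * (1 + 2 * R) ^ α * (1 + ‖x‖) ^ (-α) with hT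
  calc ENNReal.ofReal (1 - T) =
      ∫⁻ _, ENNReal.ofReal (1 - T)
        ∂(cond (volume : Measure Plane) (Metric.closedBall 0 R)) := by simp
    _ ≤ _ := by
      refine lintegral_mono_ae ?_
      filter_upwards [ae_cond_mem (μ := (volume : Measure Plane))
        (measurableSet_closedBall (x := (0 : Plane)) (ε := R))] with d hd
      rw [mem_closedBall_zero_iff] at hd
      refine ENNReal.ofReal_le_ofReal ?_
      have h1 : R / (1 + 2 * R) * (1 + ‖x‖) ≤ ‖x + d‖ := by
        have h2 : ‖x‖ - ‖d‖ ≤ ‖x + d‖ := by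
          have := norm_sub_norm_le x (-d)
          rwa [norm_neg, sub_neg_eq_add] at this
        have h3 : R / (1 + 2 * R) * (1 + ‖x‖) ≤ ‖x‖ / 2 := by
          rw [div_mul_eq_mul_div, div_le_div_iff₀ (by positivity) two_pos]
          nlinarith
        linarith
      have h4 : ‖x + d‖ ^ (-α) ≤ (R / (1 + 2 * R) * (1 + ‖x‖)) ^ (-α) :=
        Real.rpow_le_rpow_of_nonpos (by positivity) h1 (by linarith)
      have h5 : ‖d‖ ^ α ≤ R ^ α := Real.rpow_le_rpow (norm_nonneg _) hd hα.le
      have h6 : R ^ α * (R / (1 + 2 * R) * (1 + ‖x‖)) ^ (-α) =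
          (1 + 2 * R) ^ α * (1 + ‖x‖) ^ (-α) := by
        rw [Real.mul_rpow (by positivity) (by positivity), Real.rpow_neg (x := R / _)
          (by positivity), Real.div_rpow hR.le (by positivity), ← mul_assoc]
        have : 0 < R ^ α := by positivity
        field_simp
      have h7 : s * ‖d‖ ^ α * ‖x + d‖ ^ (-α) ≤ T := by
        rw [hT, mul_assoc, mul_assoc, ← h6]
        gcongr
      set t := s * ‖d‖ ^ α * ‖x + d‖ ^ (-α) with ht
      have ht0 : 0 ≤ t := by positivity
      rw [le_div_iff₀ (by linarith)]
      nlinarith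

section Radial

variable (m : ℝ≥0) {R α : ℝ} (N L : ℕ) (n : Fin N) {s : ℝ}

lemma channelPMF_nonneg (u : ℕ) : 0 ≤ channelPMF m N L n u := measureReal_nonneg

lemma sum_channelPMF : ∑ u ∈ Finset.range (L + 1), channelPMF m N L n u = 1 := by
  have h := lintegral_scheduleLaw_pow_card m N L n 1
  simp only [one_pow, lintegral_const, measure_univ, mul_one] at h
  rw [← ENNReal.ofReal_sum_of_nonneg fun u _ => channelPMF_nonneg m N L n u] at h
  have := congrArg ENNReal.toReal h
  rwa [ENNReal.toReal_ofReal (Finset.sum_nonneg fun u _ => channelPMF_nonneg m N L n u),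
    ENNReal.toReal_one, eq_comm] at this

lemma clusterLaplace_eq_ofReal (hR : 0 < R) (hs : 0 ≤ s) (x : Plane) :
    clusterLaplace m R α N L n s x = ENNReal.ofReal (∑ u ∈ Finset.range (L + 1),
      channelPMF m N L n u * diskAverage R α ‖x‖ s ^ u) := by
  have h0 := diskAverage_nonneg R α hR hs (norm_nonneg x)
  rw [clusterLaplace_eq_sum m hR α N L n hs, ENNReal.ofReal_sum_of_nonneg fun u _ =>
    mul_nonneg (channelPMF_nonneg m N L n u) (pow_nonneg h0 u)]
  refine Finset.sum_congr rfl fun u _ => ?_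
  rw [deviceLaplace_eq_diskAverage hR α hs, ENNReal.ofReal_mul (channelPMF_nonneg m N L n u),
    ENNReal.ofReal_pow h0]

lemma measurable_clusterLaplace (hR : 0 < R) (α s : ℝ) :
    Measurable (clusterLaplace m R α N L n s) := by
  have := isProbabilityMeasure_clusterLaw m hR N L
  exact (measurable_negExp.comp
    ((measurable_clusterInterference α n).const_mul _)).lintegral_prod_right'

lemma clusterLaplace_le_one (hR : 0 < R) (α s : ℝ) (x : Plane) :
    clusterLaplace m R α N L n s x ≤ 1 := by
  have := isProbabilityMeasure_clusterLaw m hR N L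
  calc clusterLaplace m R α N L n s x ≤ ∫⁻ _, 1 ∂(clusterLaw m R N L) :=
        lintegral_mono fun b => negExp_le_one _
    _ = 1 := by simp

/-- The defect `1 - E[exp (-s I_x)]` of a cluster at `x` decays like `‖x‖ ^ (-α)`. -/
lemma one_sub_sum_le (hR : 0 < R) (hα : 0 < α) (hs : 0 ≤ s) (x : Plane) :
    1 - ∑ u ∈ Finset.range (L + 1), channelPMF m N L n u * diskAverage R α ‖x‖ s ^ u ≤
      (1 + L * s) * (1 + 2 * R) ^ α * (1 + ‖x‖) ^ (-α) := by
  have hy0 := diskAverage_nonneg R α hR hs (norm_nonneg x)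
  have hy1 : diskAverage R α ‖x‖ s ≤ 1 := by
    have := deviceLaplace_le_one hR α hs x
    rwa [deviceLaplace_eq_diskAverage hR α hs, ENNReal.ofReal_le_one] at this
  set y := diskAverage R α ‖x‖ s with hy
  set T := (1 + 2 * R) ^ α * (1 + ‖x‖) ^ (-α) with hT
  have hT0 : 0 ≤ T := by positivity
  have hTe : (1 + L * s) * (1 + 2 * R) ^ α * (1 + ‖x‖) ^ (-α) = T + L * (s * T) := by
    rw [hT]; ring
  rw [hTe]
  rcases le_total (2 * R) ‖x‖ with hx | hx
  · have h1 : 1 - s * T ≤ y := by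
      have := one_sub_le_deviceLaplace hR hα hs hx
      rw [deviceLaplace_eq_diskAverage hR α hs, ENNReal.ofReal_le_ofReal_iff hy0, mul_assoc]
        at this
      exact this
    have h2 : 1 - L * (s * T) ≤ y ^ L := by
      have := one_add_mul_le_pow (show (-2 : ℝ) ≤ y - 1 by linarith) L
      rw [add_sub_cancel] at this
      have h3 : (L : ℝ) * (1 - s * T - 1) ≤ L * (y - 1) := by gcongr
      linarith
    have h3 : y ^ L ≤ ∑ u ∈ Finset.range (L + 1), channelPMF m N L n u * y ^ u := by
      calc y ^ L = ∑ u ∈ Finset.range (L + 1), channelPMF m N L n u * y ^ L := by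
            rw [← Finset.sum_mul, sum_channelPMF, one_mul]
        _ ≤ _ := by
            refine Finset.sum_le_sum fun u hu => ?_
            refine mul_le_mul_of_nonneg_left ?_ (channelPMF_nonneg m N L n u)
            exact pow_le_pow_of_le_one hy0 hy1 (Nat.lt_succ_iff.1 (Finset.mem_range.1 hu))
    linarith
  · have h1 : 1 ≤ T := by
      rw [hT, Real.rpow_neg (by positivity), ← div_eq_mul_inv, one_le_div (by positivity)]
      exact Real.rpow_le_rpow (by positivity) (by linarith) hα.le
    have h2 : 0 ≤ ∑ u ∈ Finset.range (L + 1), channelPMF m N L n u * y ^ u :=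
      Finset.sum_nonneg fun u _ => mul_nonneg (channelPMF_nonneg m N L n u) (pow_nonneg hy0 u)
    have h3 : 0 ≤ L * (s * T) := by positivity
    linarith

lemma sum_channelPMF_mul_pow_le_one (hR : 0 < R) (hs : 0 ≤ s) (x : Plane) :
    ∑ u ∈ Finset.range (L + 1), channelPMF m N L n u * diskAverage R α ‖x‖ s ^ u ≤ 1 := by
  have := clusterLaplace_le_one m N L n hR α s x
  rwa [clusterLaplace_eq_ofReal m N L n hR hs, ENNReal.ofReal_le_one] at this

/-- Here the condition `α > 2` on the path-loss exponent enters: it makes the interference of far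
clusters summable in the plane. -/
lemma integrable_one_sub_sum (hR : 0 < R) (hα : 2 < α) (hs : 0 ≤ s) :
    Integrable (fun x : Plane => 1 - ∑ u ∈ Finset.range (L + 1),
      channelPMF m N L n u * diskAverage R α ‖x‖ s ^ u) := by
  have hB : Integrable fun x : Plane => (1 + L * s) * (1 + 2 * R) ^ α * (1 + ‖x‖) ^ (-α) :=
    (integrable_one_add_norm (by simpa using hα)).const_mul _
  have he : ∀ x : Plane, 1 - ∑ u ∈ Finset.range (L + 1),
      channelPMF m N L n u * diskAverage R α ‖x‖ s ^ u =
        1 - (clusterLaplace m R α N L n s x).toReal := fun x => by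
    rw [clusterLaplace_eq_ofReal m N L n hR hs, ENNReal.toReal_ofReal]
    exact Finset.sum_nonneg fun u _ => mul_nonneg (channelPMF_nonneg m N L n u)
      (pow_nonneg (diskAverage_nonneg R α hR hs (norm_nonneg x)) u)
  refine hB.mono' ?_ (Filter.Eventually.of_forall fun x => ?_)
  · simp_rw [he]
    exact (measurable_const.sub
      (measurable_clusterLaplace m N L n hR α s).ennreal_toReal).aestronglyMeasurable
  · rw [Real.norm_of_nonneg (sub_nonneg.2 (sum_channelPMF_mul_pow_le_one m N L n hR hs x))]
    exact one_sub_sum_le m N L n hR (by linarith) hs x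

lemma integrableOn_laplaceIntegrand (hR : 0 < R) (hα : 2 < α) (hs : 0 ≤ s) :
    IntegrableOn (laplaceIntegrand m R α N L n s) (Set.Ioi 0) := by
  have h := (integrable_fun_norm_addHaar (volume : Measure Plane) (f := fun r =>
    1 - ∑ u ∈ Finset.range (L + 1), channelPMF m N L n u * diskAverage R α r s ^ u)).1
      (integrable_one_sub_sum m N L n hR hα hs)
  refine h.neg.congr (Filter.Eventually.of_forall fun r => ?_)
  simp [laplaceIntegrand]
  ring

lemma lintegral_one_sub_clusterLaplace (hR : 0 < R) (hα : 2 < α) (hs : 0 ≤ s) :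
    ∫⁻ x, (1 - clusterLaplace m R α N L n s x) =
      ENNReal.ofReal (-(2 * Real.pi * ∫ r in Set.Ioi 0, laplaceIntegrand m R α N L n s r)) := by
  have hi := integrable_one_sub_sum m N L n hR hα hs
  have hle := fun x => sum_channelPMF_mul_pow_le_one (α := α) m N L n hR hs x
  have h1 : ∀ x, 1 - clusterLaplace m R α N L n s x = ENNReal.ofReal
      (1 - ∑ u ∈ Finset.range (L + 1), channelPMF m N L n u * diskAverage R α ‖x‖ s ^ u) := by
    intro x
    rw [clusterLaplace_eq_ofReal m N L n hR hs, ENNReal.ofReal_sub, ENNReal.ofReal_one]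
    exact Finset.sum_nonneg fun u _ => mul_nonneg (channelPMF_nonneg m N L n u)
      (pow_nonneg (diskAverage_nonneg R α hR hs (norm_nonneg x)) u)
  simp_rw [h1]
  rw [← ofReal_integral_eq_lintegral_ofReal hi
    (Filter.Eventually.of_forall fun x => sub_nonneg.2 (hle x))]
  congr 1
  have h := integral_fun_norm_addHaar (volume : Measure Plane) (fun r =>
    1 - ∑ u ∈ Finset.range (L + 1), channelPMF m N L n u * diskAverage R α r s ^ u)
  rw [h]
  have hv : (volume : Measure Plane).real (Metric.ball 0 1) = Real.pi := by
    simp [Measure.real, EuclideanSpace.volume_ball_fin_two, Real.pi_pos.le]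
  have h2 : ∀ r : ℝ, laplaceIntegrand m R α N L n s r = -(r ^ (Module.finrank ℝ Plane - 1) •
      (1 - ∑ u ∈ Finset.range (L + 1), channelPMF m N L n u * diskAverage R α r s ^ u)) := by
    intro r
    simp [laplaceIntegrand]
    ring
  simp_rw [h2, integral_neg, hv]
  simp
  ring

end Radial

/-! ### Independence of the typical cluster and the interference -/

lemma ProbabilityTheory.IndepFun.prodMk_swap {Ω β γ δ : Type*} [MeasurableSpace Ω]
    [MeasurableSpace β] [MeasurableSpace γ] [MeasurableSpace δ] {P : Measure Ω}
    [IsProbabilityMeasure P] {f : Ω → β} {g : Ω → γ} {h : Ω → δ}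
    (hf : Measurable f) (hg : Measurable g) (hh : Measurable h)
    (h1 : IndepFun f (fun ω => (g ω, h ω)) P) (h2 : IndepFun g h P) :
    IndepFun g (fun ω => (f ω, h ω)) P := by
  have : IsProbabilityMeasure (P.map f) := Measure.isProbabilityMeasure_map hf.aemeasurable
  have : IsProbabilityMeasure (P.map g) := Measure.isProbabilityMeasure_map hg.aemeasurable
  have : IsProbabilityMeasure (P.map h) := Measure.isProbabilityMeasure_map hh.aemeasurable
  have h3 : IndepFun f h P := h1.comp measurable_id measurable_snd
  rw [indepFun_iff_map_prod_eq_prod_map_map (by fun_prop) (by fun_prop)] at h1 h2 h3 ⊢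
  rw [h3]
  rw [h2] at h1
  have hφ : Measurable fun p : β × γ × δ => (p.2.1, p.1, p.2.2) := by fun_prop
  have h4 : P.map (fun ω => (g ω, f ω, h ω)) =
      ((P.map f).prod ((P.map g).prod (P.map h))).map fun p => (p.2.1, p.1, p.2.2) := by
    rw [← h1, Measure.map_map hφ (by fun_prop)]
    rfl
  rw [h4]
  refine Measure.ext fun S hS => ?_
  rw [Measure.map_apply hφ hS, Measure.prod_apply (hφ hS), Measure.prod_apply hS]
  have e1 : ∀ a, (P.map g).prod (P.map h)
      (Prod.mk a ⁻¹' ((fun p : β × γ × δ => (p.2.1, p.1, p.2.2)) ⁻¹' S)) =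
      ∫⁻ b, P.map h {c | (b, a, c) ∈ S} ∂(P.map g) := fun a => by
    rw [Measure.prod_apply (measurable_prodMk_left (hφ hS))]
    rfl
  have e2 : ∀ b, (P.map f).prod (P.map h) (Prod.mk b ⁻¹' S) =
      ∫⁻ a, P.map h {c | (b, a, c) ∈ S} ∂(P.map f) := fun b => by
    rw [Measure.prod_apply (measurable_prodMk_left hS)]
    rfl
  simp_rw [e1, e2]
  refine lintegral_lintegral_swap ?_
  have hψ : Measurable fun q : (β × γ) × δ => (q.1.2, q.1.1, q.2) := by fun_prop
  exact (measurable_measure_prodMk_left (hψ hS)).aemeasurable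

namespace RRSNetwork

variable {Ω : Type*} [MeasurableSpace Ω] {P : Measure Ω} {lam m : ℝ≥0} {R : ℝ} {N L : ℕ}

lemma interference_eq (M : RRSNetwork P lam m R N L) (α : ℝ) (n : Fin N) (ω : Ω) :
    M.interference α n ω =
      ∑' i, clusterInterference α n (M.agg ω i) (M.mark (some i) ω) := rfl

lemma measurable_tsum_clusterInterference (α : ℝ) (n : Fin N) :
    Measurable fun p : (ℕ → Plane) × (ℕ → ClusterMark N L) =>
      ∑' i, clusterInterference α n (p.1 i) (p.2 i) := by
  refine Measurable.tsum fun i => ?_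
  fun_prop

lemma measurable_someMarks (M : RRSNetwork P lam m R N L) :
    Measurable fun ω (i : ℕ) => M.mark (some i) ω :=
  measurable_pi_lambda _ fun _ => M.measurable_mark _

lemma measurable_interference (M : RRSNetwork P lam m R N L) (α : ℝ) (n : Fin N) :
    Measurable (M.interference α n) := by
  have := (measurable_tsum_clusterInterference (L := L) α n).comp
    (M.measurable_agg.prodMk M.measurable_someMarks)
  exact this

lemma indepFun_mark_none_someMarks (M : RRSNetwork P lam m R N L) :
    IndepFun (M.mark none) (fun ω (i : ℕ) => M.mark (some i) ω) P := by
  have h := indep_iSup_of_disjoint (S := {none}) (T := {none}ᶜ)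
    (fun i => (M.measurable_mark i).comap_le) M.mark_indep disjoint_compl_right
  refine indep_of_indep_of_le_left (indep_of_indep_of_le_right h ?_) ?_
  · rw [MeasurableSpace.pi, MeasurableSpace.comap_iSup]
    refine iSup_le fun i => ?_
    rw [MeasurableSpace.comap_comp]
    exact le_iSup₂_of_le (some i) (by simp) le_rfl
  · exact le_iSup₂_of_le none rfl le_rfl

lemma indepFun_mark_none_interference [IsProbabilityMeasure P] (M : RRSNetwork P lam m R N L)
    (α : ℝ) (n : Fin N) : IndepFun (M.mark none) (M.interference α n) P := by
  have hφ : Measurable fun b : Option ℕ → ClusterMark N L => (b none, fun i : ℕ => b (some i)) := by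
    fun_prop
  have h1 : IndepFun M.agg (fun ω => (M.mark none ω, fun i : ℕ => M.mark (some i) ω)) P :=
    M.agg_indep.comp measurable_id hφ
  have h2 := h1.prodMk_swap M.measurable_agg (M.measurable_mark none) M.measurable_someMarks
    M.indepFun_mark_none_someMarks
  exact h2.comp measurable_id (measurable_tsum_clusterInterference α n)

/-! ### The Laplace transform of the interference -/

/-- Given the locations of the aggregators, the clusters contribute independent factors. -/
lemma lintegral_prod_range_negExp [IsProbabilityMeasure P] (M : RRSNetwork P lam m R N L) (α : ℝ)
    (n : Fin N) (s : ℝ) (k : ℕ) :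
    ∫⁻ ω, ∏ i ∈ Finset.range k, negExp (ENNReal.ofReal s *
        clusterInterference α n (M.agg ω i) (M.mark (some i) ω)) ∂P =
      ∫⁻ ω, ∏ i ∈ Finset.range k, clusterLaplace m R α N L n s (M.agg ω i) ∂P := by
  let F : (ℕ → Plane) × (Option ℕ → ClusterMark N L) → ℝ≥0∞ := fun p =>
    ∏ i ∈ Finset.range k,
      negExp (ENNReal.ofReal s * clusterInterference α n (p.1 i) (p.2 (some i)))
  have hF : Measurable F := by
    refine Finset.measurable_prod _ fun i _ => ?_
    fun_prop
  have hmk : Measurable fun ω i => M.mark i ω := measurable_pi_lambda _ M.measurable_mark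
  have hlaw := (indepFun_iff_map_prod_eq_prod_map_map M.measurable_agg.aemeasurable
    hmk.aemeasurable).1 M.agg_indep
  have : IsProbabilityMeasure (P.map fun ω i => M.mark i ω) :=
    Measure.isProbabilityMeasure_map hmk.aemeasurable
  have h1 : ∫⁻ ω, F (M.agg ω, fun i => M.mark i ω) ∂P =
      ∫⁻ ω, ∫⁻ ω', F (M.agg ω, fun i => M.mark i ω') ∂P ∂P := by
    rw [← lintegral_map (f := F) (g := fun ω => (M.agg ω, fun i => M.mark i ω)) hF
      (M.measurable_agg.prodMk hmk), hlaw, lintegral_prod _ hF.aemeasurable,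
      lintegral_map hF.lintegral_prod_right' M.measurable_agg]
    refine lintegral_congr fun ω => ?_
    exact lintegral_map (hF.comp measurable_prodMk_left) hmk
  refine h1.trans (lintegral_congr fun ω => ?_)
  have hm : ∀ x, Measurable fun b : ClusterMark N L =>
      negExp (ENNReal.ofReal s * clusterInterference α n x b) := fun x => by
    fun_prop
  have hind : iIndepFun (fun (i : ℕ) ω' => negExp (ENNReal.ofReal s *
      clusterInterference α n (M.agg ω i) (M.mark (some i) ω'))) P :=
    (M.mark_indep.precomp (Option.some_injective ℕ)).comp
      (fun i b => negExp (ENNReal.ofReal s * clusterInterference α n (M.agg ω i) b))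
      (fun i => hm _)
  refine (lintegral_prod_eq_prod_lintegral_of_indepFun _ _ hind
    (fun i => (hm _).comp (M.measurable_mark _))).trans ?_
  refine Finset.prod_congr rfl fun i _ => ?_
  rw [clusterLaplace, ← M.mark_law (some i), lintegral_map (hm _) (M.measurable_mark _)]

theorem lintegral_negExp_interference [IsProbabilityMeasure P] (M : RRSNetwork P lam m R N L)
    (hR : 0 < R) (α : ℝ) (n : Fin N) (s : ℝ) :
    ∫⁻ ω, negExp (ENNReal.ofReal s * M.interference α n ω) ∂P =
      negExp (lam * ∫⁻ x, (1 - clusterLaplace m R α N L n s x)) := by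
  have hφ := measurable_clusterLaplace m N L n hR α s
  obtain ⟨g, hg, hgφ⟩ := exists_measurable_negExp_eq hφ (clusterLaplace_le_one m N L n hR α s)
  have hPPP := M.agg_poisson.lintegral_negExp_tsum M.measurable_agg hg
  simp_rw [hgφ] at hPPP
  rw [← hPPP]
  have hl := M.lintegral_prod_range_negExp α n s
  have hagg : ∀ i, Measurable fun ω => M.agg ω i := fun i =>
    (measurable_pi_apply i).comp M.measurable_agg
  have t1 : Filter.Tendsto (fun k => ∫⁻ ω, ∏ i ∈ Finset.range k, negExp (ENNReal.ofReal s *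
        clusterInterference α n (M.agg ω i) (M.mark (some i) ω)) ∂P) Filter.atTop
      (nhds (∫⁻ ω, negExp (ENNReal.ofReal s * M.interference α n ω) ∂P)) := by
    refine tendsto_lintegral_of_dominated_convergence 1 (fun k => ?_) (fun k => ?_) (by simp) ?_
    · refine Finset.measurable_prod _ fun i _ => ?_
      have := hagg i
      have := M.measurable_mark (some i)
      fun_prop
    · exact Filter.Eventually.of_forall fun ω => Finset.prod_le_one' fun i _ => negExp_le_one _
    · refine Filter.Eventually.of_forall fun ω => ?_
      rw [interference_eq, ← ENNReal.tsum_mul_left]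
      exact tendsto_negExp_sum_range _
  have t2 : Filter.Tendsto (fun k => ∫⁻ ω, ∏ i ∈ Finset.range k,
        clusterLaplace m R α N L n s (M.agg ω i) ∂P) Filter.atTop
      (nhds (∫⁻ ω, negExp (∑' i, g (M.agg ω i)) ∂P)) := by
    refine tendsto_lintegral_of_dominated_convergence 1 (fun k => ?_) (fun k => ?_) (by simp) ?_
    · exact Finset.measurable_prod _ fun i _ => hφ.comp (hagg i)
    · exact Filter.Eventually.of_forall fun ω => Finset.prod_le_one' fun i _ =>
        clusterLaplace_le_one m N L n hR α s _
    · refine Filter.Eventually.of_forall fun ω => ?_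
      simp_rw [← hgφ]
      exact tendsto_negExp_sum_range _
  simp_rw [hl] at t1
  exact tendsto_nhds_unique t1 t2

lemma tendsto_negExp_ofReal_mul (t : ℝ≥0∞) :
    Filter.Tendsto (fun k : ℕ => negExp (ENNReal.ofReal (1 / ((k : ℝ) + 1)) * t)) Filter.atTop
      (nhds (if t = ∞ then 0 else 1)) := by
  split_ifs with ht
  · have h : ∀ k : ℕ, negExp (ENNReal.ofReal (1 / ((k : ℝ) + 1)) * t) = 0 := fun k => by
      rw [ht, ENNReal.mul_top, negExp_top]
      rw [ne_eq, ENNReal.ofReal_eq_zero, not_le]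
      positivity
    simp_rw [h]
    exact tendsto_const_nhds
  · have h1 : Filter.Tendsto (fun k : ℕ => ENNReal.ofReal (1 / ((k : ℝ) + 1)) * t) Filter.atTop
        (nhds (ENNReal.ofReal 0 * t)) :=
      ENNReal.Tendsto.mul_const
        (ENNReal.tendsto_ofReal tendsto_one_div_add_atTop_nhds_zero_nat) (Or.inr ht)
    rw [ENNReal.ofReal_zero, zero_mul] at h1
    rw [← negExp_zero]
    exact (continuous_negExp.tendsto 0).comp h1

/-- The Laplace transform tends to `P (I < ∞)` at `0`, and its closed form tends to `1`. -/
theorem ae_interference_ne_top [IsProbabilityMeasure P] (M : RRSNetwork P lam m R N L)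
    (hR : 0 < R) {α : ℝ} (hα : 2 < α) (n : Fin N) : ∀ᵐ ω ∂P, M.interference α n ω ≠ ∞ := by
  have := isProbabilityMeasure_clusterLaw m hR N L
  have hI := M.measurable_interference α n
  have t1 : Filter.Tendsto (fun k : ℕ => ∫⁻ ω, negExp (ENNReal.ofReal (1 / ((k : ℝ) + 1)) *
        M.interference α n ω) ∂P) Filter.atTop
      (nhds (∫⁻ ω, (if M.interference α n ω = ∞ then 0 else 1) ∂P)) :=
    tendsto_lintegral_of_dominated_convergence 1
      (fun k => measurable_negExp.comp (hI.const_mul _))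
      (fun k => Filter.Eventually.of_forall fun ω => negExp_le_one _) (by simp)
      (Filter.Eventually.of_forall fun ω => tendsto_negExp_ofReal_mul _)
  have t2 : ∀ x, Filter.Tendsto (fun k : ℕ => clusterLaplace m R α N L n (1 / ((k : ℝ) + 1)) x)
      Filter.atTop (nhds 1) := fun x => by
    have h1 : ∫⁻ _, 1 ∂(clusterLaw m R N L) = 1 := by simp
    rw [← h1]
    refine tendsto_lintegral_of_dominated_convergence 1 (fun k => ?_)
      (fun k => Filter.Eventually.of_forall fun ω => negExp_le_one _) (by simp)
      (Filter.Eventually.of_forall fun b => ?_)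
    · fun_prop
    · have h2 := tendsto_negExp_ofReal_mul (clusterInterference α n x b)
      rwa [if_neg] at h2
      exact ENNReal.sum_ne_top.2 fun j _ => ENNReal.ofReal_ne_top
  have t3 : Filter.Tendsto (fun k : ℕ =>
      ∫⁻ x, (1 - clusterLaplace m R α N L n (1 / ((k : ℝ) + 1)) x)) Filter.atTop (nhds 0) := by
    have h0 : ∫⁻ _ : Plane, (0 : ℝ≥0∞) = 0 := by simp
    rw [← h0]
    refine tendsto_lintegral_of_dominated_convergence
      (fun x => 1 - clusterLaplace m R α N L n 1 x) (fun k => ?_) (fun k => ?_) ?_ ?_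
    · exact measurable_const.sub (measurable_clusterLaplace m N L n hR α _)
    · refine Filter.Eventually.of_forall fun x => tsub_le_tsub_left ?_ 1
      refine lintegral_mono fun b => antitone_negExp (mul_le_mul_left ?_ _)
      exact ENNReal.ofReal_le_ofReal (div_le_one_of_le₀ (by linarith [k.cast_nonneg (α := ℝ)])
        (by positivity))
    · rw [lintegral_one_sub_clusterLaplace m N L n hR hα zero_le_one]
      exact ENNReal.ofReal_ne_top
    · refine Filter.Eventually.of_forall fun x => ?_
      have := ENNReal.Tendsto.sub (tendsto_const_nhds (x := (1 : ℝ≥0∞))) (t2 x) (Or.inl (by simp))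
      simpa using this
  simp_rw [M.lintegral_negExp_interference hR] at t1
  have t4 : Filter.Tendsto (fun k : ℕ => negExp (lam *
      ∫⁻ x, (1 - clusterLaplace m R α N L n (1 / ((k : ℝ) + 1)) x))) Filter.atTop (nhds 1) := by
    have := ENNReal.Tendsto.const_mul t3 (Or.inr (ENNReal.coe_ne_top (r := lam)))
    rw [mul_zero] at this
    have h0 := (continuous_negExp.tendsto 0).comp this
    rwa [negExp_zero] at h0
  have h1 := tendsto_nhds_unique t1 t4
  have hset : MeasurableSet {ω | M.interference α n ω ≠ ∞} :=
    (hI (measurableSet_singleton ∞)).compl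
  have h2 : P {ω | M.interference α n ω ≠ ∞} = 1 := by
    rw [← h1, ← lintegral_indicator_one hset]
    refine lintegral_congr fun ω => ?_
    by_cases h : M.interference α n ω = ∞ <;> simp [h]
  rw [ae_iff]
  exact (prob_compl_eq_zero_iff hset).2 h2

lemma integrable_exp_interference [IsProbabilityMeasure P] (M : RRSNetwork P lam m R N L) (α : ℝ)
    (n : Fin N) {s : ℝ} (hs : 0 ≤ s) :
    Integrable (fun ω => Real.exp (-(s * (M.interference α n ω).toReal))) P := by
  have hI := M.measurable_interference α n
  have hm : Measurable fun ω => Real.exp (-(s * (M.interference α n ω).toReal)) := by fun_prop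
  refine Integrable.of_bound hm.aestronglyMeasurable 1 (Filter.Eventually.of_forall fun ω => ?_)
  rw [Real.norm_of_nonneg (Real.exp_pos _).le, Real.exp_le_one_iff, neg_nonpos]
  positivity

theorem laplace_eq [IsProbabilityMeasure P] (M : RRSNetwork P lam m R N L) (hR : 0 < R) {α : ℝ}
    (hα : 2 < α) (n : Fin N) {s : ℝ} (hs : 0 ≤ s) :
    M.laplace α n s = Real.exp (2 * Real.pi * lam *
      ∫ rw in Set.Ioi 0, laplaceIntegrand m R α N L n s rw) := by
  have h1 : ENNReal.ofReal (M.laplace α n s) =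
      ∫⁻ ω, negExp (ENNReal.ofReal s * M.interference α n ω) ∂P := by
    rw [laplace, ofReal_integral_eq_lintegral_ofReal (M.integrable_exp_interference α n hs)
      (Filter.Eventually.of_forall fun ω => (Real.exp_pos _).le)]
    refine lintegral_congr_ae ?_
    filter_upwards [M.ae_interference_ne_top hR hα n] with ω hω
    rw [negExp_of_ne_top (ENNReal.mul_ne_top ENNReal.ofReal_ne_top hω), ENNReal.toReal_mul,
      ENNReal.toReal_ofReal hs]
  have hnn : 0 ≤ -(2 * Real.pi * ∫ r in Set.Ioi 0, laplaceIntegrand m R α N L n s r) := by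
    rw [neg_nonneg]
    refine mul_nonpos_of_nonneg_of_nonpos (by positivity) ?_
    refine setIntegral_nonpos measurableSet_Ioi fun r hr => ?_
    refine mul_nonpos_of_nonneg_of_nonpos (le_of_lt hr) (sub_nonpos.2 ?_)
    obtain ⟨x, hx⟩ : ∃ x : Plane, ‖x‖ = r :=
      ⟨EuclideanSpace.single 0 r, by simp [abs_of_pos (show 0 < r from hr)]⟩
    rw [← hx]
    exact sum_channelPMF_mul_pow_le_one m N L n hR hs x
  rw [M.lintegral_negExp_interference hR, lintegral_one_sub_clusterLaplace m N L n hR hα hs,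
    negExp_of_ne_top (ENNReal.mul_ne_top ENNReal.coe_ne_top ENNReal.ofReal_ne_top),
    ENNReal.toReal_mul, ENNReal.toReal_ofReal hnn, ENNReal.coe_toReal] at h1
  have h2 := (ENNReal.ofReal_eq_ofReal_iff
    (integral_nonneg fun ω => (Real.exp_pos _).le) (Real.exp_pos _).le).1 h1
  refine h2.trans ?_
  congr 1
  ring

/-! ### Conditioning on the number of devices on the channel -/

lemma measure_sharing (M : RRSNetwork P lam m R N L) (hR : 0 < R) (n : Fin N) (u : ℕ) :
    P (M.sharing n u) = scheduleLaw m N L {a | (a.onChannel n).card = u} := by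
  have := isProbabilityMeasure_cond_closedBall hR
  have hS : MeasurableSet {a : Schedule N L | (a.onChannel n).card = u} := MeasurableSet.of_discrete
  have h1 : P (M.sharing n u) =
      clusterLaw m R N L (Prod.fst ⁻¹' {a | (a.onChannel n).card = u}) := by
    rw [← M.mark_law none, Measure.map_apply (M.measurable_mark none) (measurable_fst hS)]
    rfl
  rw [h1, clusterLaw, (measurePreserving_fst).measure_preimage hS.nullMeasurableSet]

/-- If for every schedule with `u` devices on the channel and every value `t` of the interference
an event on the devices has probability `f t`, then its conditional probability given that `u`
devices share the channel is `E[f I]`. -/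
lemma cond_sharing_real_eq [IsProbabilityMeasure P] (M : RRSNetwork P lam m R N L) (hR : 0 < R)
    {α : ℝ} (hα : 2 < α) (n : Fin N) (u : ℕ)
    (hu : scheduleLaw m N L {a | (a.onChannel n).card = u} ≠ 0)
    {A : Set (ClusterMark N L × ℝ≥0∞)} (hA : MeasurableSet A) {f : ℝ≥0∞ → ℝ}
    (hf : Measurable f) (hf0 : ∀ t, 0 ≤ f t)
    (h : ∀ a : Schedule N L, (a.onChannel n).card = u → ∀ t ≠ ∞,
      (Measure.infinitePi fun _ : ℕ => deviceLaw R) {q | ((a, q), t) ∈ A} =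
        ENNReal.ofReal (f t)) :
    (cond P (M.sharing n u)).real {ω | (M.mark none ω, M.interference α n ω) ∈ A} =
      ∫ ω, f (M.interference α n ω) ∂P := by
  have := isProbabilityMeasure_cond_closedBall hR
  have := isProbabilityMeasure_clusterLaw m hR N L
  have hI := M.measurable_interference α n
  have hmn := M.measurable_mark none
  have hS : MeasurableSet {a : Schedule N L | (a.onChannel n).card = u} := MeasurableSet.of_discrete
  have hsh : MeasurableSet (M.sharing n u) := (measurable_fst.comp hmn) hS
  have hB : MeasurableSet (A ∩ {p | (p.1.1.onChannel n).card = u}) :=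
    hA.inter ((measurable_fst.comp measurable_fst) hS)
  have hlaw := (indepFun_iff_map_prod_eq_prod_map_map hmn.aemeasurable hI.aemeasurable).1
    (M.indepFun_mark_none_interference α n)
  have key : P (M.sharing n u ∩ {ω | (M.mark none ω, M.interference α n ω) ∈ A}) =
      scheduleLaw m N L {a | (a.onChannel n).card = u} *
        ∫⁻ ω, ENNReal.ofReal (f (M.interference α n ω)) ∂P := by
    have e1 : P (M.sharing n u ∩ {ω | (M.mark none ω, M.interference α n ω) ∈ A}) =
        P.map (fun ω => (M.mark none ω, M.interference α n ω))
          (A ∩ {p | (p.1.1.onChannel n).card = u}) := by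
      rw [Measure.map_apply (hmn.prodMk hI) hB, Set.inter_comm]
      rfl
    rw [e1, hlaw, M.mark_law, Measure.prod_apply_symm hB,
      lintegral_map (measurable_measure_prodMk_right hB) hI,
      ← lintegral_const_mul _ (by fun_prop)]
    refine lintegral_congr_ae ?_
    filter_upwards [M.ae_interference_ne_top hR hα n] with ω hω
    rw [clusterLaw, Measure.prod_apply (measurable_prodMk_right hB), mul_comm,
      ← lintegral_indicator_const hS]
    refine lintegral_congr fun a => ?_
    by_cases ha : (a.onChannel n).card = u
    · rw [Set.indicator_of_mem (show a ∈ {a : Schedule N L | (a.onChannel n).card = u} from ha),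
        ← h a ha _ hω]
      congr 1
      ext q
      exact ⟨fun h => h.1, fun h => ⟨h, ha⟩⟩
    · rw [Set.indicator_of_notMem (show a ∉ {a : Schedule N L | (a.onChannel n).card = u} from ha)]
      refine measure_mono_null (fun q hq => ha hq.2) measure_empty
  have hint : ∫ ω, f (M.interference α n ω) ∂P =
      (∫⁻ ω, ENNReal.ofReal (f (M.interference α n ω)) ∂P).toReal :=
    integral_eq_lintegral_of_nonneg_ae (Filter.Eventually.of_forall fun ω => hf0 _)
      (hf.comp hI).aestronglyMeasurable
  rw [hint, Measure.real, cond_apply hsh, key, M.measure_sharing hR, ← mul_assoc,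
    ENNReal.inv_mul_cancel hu (measure_ne_top _ _), one_mul]

/-- Specialization of `cond_sharing_real_eq` to events on the coefficient of a single device. -/
lemma cond_sharing_one_real_eq [IsProbabilityMeasure P] (M : RRSNetwork P lam m R N L)
    (hR : 0 < R) {α : ℝ} (hα : 2 < α) (hm : 0 < m) (hL : 1 ≤ L) (n : Fin N)
    {K : Set (ℝ × ℝ≥0∞)} (hK : MeasurableSet K) {f : ℝ≥0∞ → ℝ} (hf : Measurable f)
    (h : ∀ t ≠ ∞, (expMeasure 1).real {x | (x, t) ∈ K} = f t) (hf0 : ∀ t, 0 ≤ f t) :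
    (cond P (M.sharing n 1)).real {ω | ∃ j, M.active n none ω = {j} ∧
        (M.fading none j ω, M.interference α n ω) ∈ K} =
      ∫ ω, f (M.interference α n ω) ∂P := by
  have := isProbabilityMeasure_cond_closedBall hR
  refine M.cond_sharing_real_eq hR hα n 1 (scheduleLaw_card_eq_one_ne_zero hm hL n)
    (A := {p | ∃ j, p.1.1.onChannel n = {j} ∧ ((p.1.2 j).2, p.2) ∈ K}) ?_ hf hf0 ?_
  · simp only [Set.ofPred_exists]
    refine MeasurableSet.iUnion fun j => ?_
    have hS : MeasurableSet {a : Schedule N L | a.onChannel n = {j}} := MeasurableSet.of_discrete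
    have hφ : Measurable fun p : ClusterMark N L × ℝ≥0∞ => ((p.1.2 j).2, p.2) := by fun_prop
    exact ((measurable_fst.comp measurable_fst) hS).inter (hφ hK)
  · intro a ha t ht
    obtain ⟨j, hj⟩ := Finset.card_eq_one.1 ha
    have hKt : MeasurableSet {x | (x, t) ∈ K} := measurable_prodMk_right hK
    have e1 : {q : ℕ → Plane × ℝ | (((a, q), t) : ClusterMark N L × ℝ≥0∞) ∈
        {p : ClusterMark N L × ℝ≥0∞ | ∃ j, p.1.1.onChannel n = {j} ∧ ((p.1.2 j).2, p.2) ∈ K}} =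
        Function.eval j ⁻¹' (Prod.snd ⁻¹' {x | (x, t) ∈ K}) := by
      ext q
      constructor
      · rintro ⟨i, hi, hq⟩
        have : i = j := by simpa using (hi.symm.trans hj)
        exact this ▸ hq
      · exact fun hq => ⟨j, hj, hq⟩
    rw [e1, (measurePreserving_eval_infinitePi (fun _ : ℕ => deviceLaw R) j).measure_preimage
      (measurable_snd hKt).nullMeasurableSet,
      measurePreserving_snd.measure_preimage hKt.nullMeasurableSet, ← h t ht, ofReal_measureReal]

/-- Specialization of `cond_sharing_real_eq` to symmetric events on the coefficients of a pair of
devices. -/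
lemma cond_sharing_two_real_eq [IsProbabilityMeasure P] (M : RRSNetwork P lam m R N L)
    (hR : 0 < R) {α : ℝ} (hα : 2 < α) (hm : 0 < m) (hL : 2 ≤ L) (n : Fin N)
    {K : Set ((ℝ × ℝ) × ℝ≥0∞)} (hK : MeasurableSet K)
    (hsymm : ∀ x y t, ((x, y), t) ∈ K → ((y, x), t) ∈ K) {f : ℝ≥0∞ → ℝ} (hf : Measurable f)
    (h : ∀ t ≠ ∞, expPair.real {p | (p, t) ∈ K} = f t) (hf0 : ∀ t, 0 ≤ f t) :
    (cond P (M.sharing n 2)).real {ω | ∃ j j', j ≠ j' ∧ M.active n none ω = {j, j'} ∧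
        ((M.fading none j ω, M.fading none j' ω), M.interference α n ω) ∈ K} =
      ∫ ω, f (M.interference α n ω) ∂P := by
  have := isProbabilityMeasure_cond_closedBall hR
  refine M.cond_sharing_real_eq hR hα n 2 (scheduleLaw_card_eq_two_ne_zero hm hL n)
    (A := {p | ∃ j j', j ≠ j' ∧ p.1.1.onChannel n = {j, j'} ∧
      (((p.1.2 j).2, (p.1.2 j').2), p.2) ∈ K}) ?_ hf hf0 ?_
  · simp only [Set.ofPred_exists]
    refine MeasurableSet.iUnion fun j => MeasurableSet.iUnion fun j' => ?_
    have hS : MeasurableSet {a : Schedule N L | a.onChannel n = {j, j'}} :=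
      MeasurableSet.of_discrete
    have hφ : Measurable fun p : ClusterMark N L × ℝ≥0∞ =>
        (((p.1.2 j).2, (p.1.2 j').2), p.2) := by fun_prop
    exact (MeasurableSet.const _).inter (((measurable_fst.comp measurable_fst) hS).inter (hφ hK))
  · intro a ha t ht
    obtain ⟨j, j', hjj', hj⟩ := Finset.card_eq_two.1 ha
    have hKt : MeasurableSet {p | (p, t) ∈ K} := measurable_prodMk_right hK
    have hsnd : MeasurePreserving (Prod.map Prod.snd Prod.snd)
        ((deviceLaw R).prod (deviceLaw R)) expPair :=
      measurePreserving_snd.prod measurePreserving_snd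
    have heval : MeasurePreserving (fun q : ℕ → Plane × ℝ => (q j, q j'))
        (Measure.infinitePi fun _ : ℕ => deviceLaw R) ((deviceLaw R).prod (deviceLaw R)) :=
      ⟨by fun_prop, Measure.infinitePi_map_eval_prod (P := fun _ : ℕ => deviceLaw R) hjj'⟩
    have e1 : {q : ℕ → Plane × ℝ | (((a, q), t) : ClusterMark N L × ℝ≥0∞) ∈
        {p : ClusterMark N L × ℝ≥0∞ | ∃ j j', j ≠ j' ∧ p.1.1.onChannel n = {j, j'} ∧
          (((p.1.2 j).2, (p.1.2 j').2), p.2) ∈ K}} =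
        (fun q : ℕ → Plane × ℝ => (q j, q j')) ⁻¹'
          (Prod.map Prod.snd Prod.snd ⁻¹' {p | (p, t) ∈ K}) := by
      ext q
      constructor
      · rintro ⟨i, i', hii', hi, hq⟩
        have hij : ({i, i'} : Finset ℕ) = {j, j'} := hi.symm.trans hj
        have hi1 : i = j ∨ i = j' := by
          have := Finset.mem_insert_self i {i'}
          rwa [hij, Finset.mem_insert, Finset.mem_singleton] at this
        have hi2 : i' = j ∨ i' = j' := by
          have := Finset.mem_insert_of_mem (b := i) (Finset.mem_singleton_self i')
          rwa [hij, Finset.mem_insert, Finset.mem_singleton] at this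
        rcases hi1 with rfl | rfl <;> rcases hi2 with rfl | rfl
        · exact absurd rfl hii'
        · exact hq
        · exact hsymm _ _ _ hq
        · exact absurd rfl hii'
      · exact fun hq => ⟨j, j', hjj', hj, hq⟩
    rw [e1, heval.measure_preimage (hsnd.measurable hKt).nullMeasurableSet,
      hsnd.measure_preimage hKt.nullMeasurableSet, ← h t ht, ofReal_measureReal]

theorem p₁₁_eq [IsProbabilityMeasure P] (M : RRSNetwork P lam m R N L) (hR : 0 < R) {α : ℝ}
    (hα : 2 < α) (hm : 0 < m) (hL : 1 ≤ L) (n : Fin N) {θ : ℝ} (hθ : 0 ≤ θ) :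
    M.p₁₁ α n θ = M.laplace α n θ := by
  refine M.cond_sharing_one_real_eq hR hα hm hL n
    (K := {p | ENNReal.ofReal θ ≤ sir₁₁ p.1 p.2})
    (f := fun t => Real.exp (-(θ * t.toReal))) ?_ (by fun_prop)
    (fun t ht => expMeasure_real_le_sir₁₁ hθ ht) (fun t => (Real.exp_pos _).le)
  unfold sir₁₁
  exact measurableSet_le measurable_const (by fun_prop)

theorem p₁₂_eq [IsProbabilityMeasure P] (M : RRSNetwork P lam m R N L) (hR : 0 < R) {α : ℝ}
    (hα : 2 < α) (hm : 0 < m) (hL : 2 ≤ L) (n : Fin N) {θ : ℝ} (hθ : 0 ≤ θ) :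
    M.p₁₂ α n θ = if θ < 1 then
        2 / (1 + θ) * M.laplace α n θ - (1 - θ) / (1 + θ) * M.laplace α n (2 * θ / (1 - θ))
      else 2 / (1 + θ) * M.laplace α n θ := by
  have hK : MeasurableSet {p : (ℝ × ℝ) × ℝ≥0∞ | ENNReal.ofReal θ ≤ sir₁₂ p.1.1 p.1.2 p.2} := by
    unfold sir₁₂; exact measurableSet_le measurable_const (by fun_prop)
  refine (M.cond_sharing_two_real_eq hR hα hm hL n hK
    (fun x y t hxy => by
      rw [Set.mem_ofPred_eq, sir₁₂, max_comm, min_comm]; exact hxy)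
    (f := fun t => expPair.real {p | ENNReal.ofReal θ ≤ sir₁₂ p.1 p.2 t})
    (measurable_measure_prodMk_right hK).ennreal_toReal
    (fun t _ => rfl) (fun t => measureReal_nonneg)).trans ?_
  rw [integral_congr_ae ((M.ae_interference_ne_top hR hα n).mono fun ω hω =>
    expPair_real_le_sir₁₂ hθ hω)]
  split_ifs with h1
  · have h2 : 0 ≤ 2 * θ / (1 - θ) := div_nonneg (by linarith) (by linarith)
    rw [integral_sub ((M.integrable_exp_interference α n hθ).const_mul _)
      ((M.integrable_exp_interference α n h2).const_mul _), integral_const_mul,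
      integral_const_mul]
    rfl
  · rw [integral_const_mul]
    rfl

theorem p₂₂_eq [IsProbabilityMeasure P] (M : RRSNetwork P lam m R N L) (hR : 0 < R) {α : ℝ}
    (hα : 2 < α) (hm : 0 < m) (hL : 2 ≤ L) (n : Fin N) {θ μ : ℝ} (hθ : 0 ≤ θ) (hμ : 0 ≤ μ) :
    M.p₂₂ α μ n θ = if θ * μ < 1 then
        (1 - θ * μ) / (1 + θ * μ) * M.laplace α n (2 * θ / (1 - θ * μ))
      else 0 := by
  have hK : MeasurableSet {p : (ℝ × ℝ) × ℝ≥0∞ | ENNReal.ofReal θ ≤ sir₂₂ μ p.1.1 p.1.2 p.2} := by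
    unfold sir₂₂; exact measurableSet_le measurable_const (by fun_prop)
  refine (M.cond_sharing_two_real_eq hR hα hm hL n hK
    (fun x y t hxy => by
      rw [Set.mem_ofPred_eq, sir₂₂, max_comm, min_comm]; exact hxy)
    (f := fun t => expPair.real {p | ENNReal.ofReal θ ≤ sir₂₂ μ p.1 p.2 t})
    (measurable_measure_prodMk_right hK).ennreal_toReal
    (fun t _ => rfl) (fun t => measureReal_nonneg)).trans ?_
  rw [integral_congr_ae ((M.ae_interference_ne_top hR hα n).mono fun ω hω =>
    expPair_real_le_sir₂₂ hθ hμ hω)]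
  split_ifs with h1
  · rw [integral_const_mul]
    rfl
  · exact integral_zero _ _

end RRSNetwork

theorem theorem1 {Ω : Type*} [MeasurableSpace Ω] (P : Measure Ω) [IsProbabilityMeasure P]
    (lam m : ℝ≥0) (R α μ θ : ℝ) (N L : ℕ) (M : RRSNetwork P lam m R N L) (n : Fin N)
    (hlam : 0 < lam) (hm : 0 < m) (hR : 0 < R) (hα : 2 < α) (hL : 1 ≤ L)
    (hμ : μ ∈ Set.Icc (0 : ℝ) 1) (hθ : 0 ≤ θ) :
    M.p₁₁ α n θ = M.laplace α n θ ∧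
    (2 ≤ L →
      M.p₁₂ α n θ =
        (if θ < 1 then
          2 / (1 + θ) * M.laplace α n θ
            - (1 - θ) / (1 + θ) * M.laplace α n (2 * θ / (1 - θ))
        else 2 / (1 + θ) * M.laplace α n θ) ∧
      M.p₂₂ α μ n θ =
        (if θ * μ < 1 then
          (1 - θ * μ) / (1 + θ * μ) * M.laplace α n (2 * θ / (1 - θ * μ))
        else 0)) ∧
    (∀ᵐ ω ∂P, M.interference α n ω ≠ ∞) ∧
    (∀ s : ℝ, 0 ≤ s →
      IntegrableOn (laplaceIntegrand m R α N L n s) (Set.Ioi 0) ∧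
      M.laplace α n s =
        Real.exp (2 * Real.pi * lam * ∫ rw in Set.Ioi 0, laplaceIntegrand m R α N L n s rw)) := by
  refine ⟨M.p₁₁_eq hR hα hm hL n hθ, fun hL2 => ⟨M.p₁₂_eq hR hα hm hL2 n hθ,
    M.p₂₂_eq hR hα hm hL2 n hθ hμ.1⟩, M.ae_interference_ne_top hR hα n, fun s hs => ⟨?_, ?_⟩⟩
  · exact integrableOn_laplaceIntegrand m N L n hR hα hs
  · exact M.laplace_eq hR hα n hs
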